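/- Let $f:S^1\to S^1$, $S^1=\mathbb R/\mathbb Z$, be an orientation-preserving $C^1$ circle diffeomorphism, let $F:\mathbb R\to\mathbb R$ be a lift of $f$, and regard $\varphi=\log f'=\log F'$ as a continuous $1$-periodic function on $\mathbb R$. Say that $\varphi$ has bounded Zygmund variation if $$\sup\sum_{i=0}^{n-1}\Bigl|\varphi(x_i)+\varphi(x_{i+1})-2\varphi\Bigl(\tfrac{x_i+x_{i+1}}2\Bigr)\Bigr|<\infty,$$ and bounded quadratic variation if $$\sup\sum_{i=0}^{n-1}\bigl(\varphi(x_{i+1})-\varphi(x_i)\bigr)^2<\infty,$$ both suprema being over all partitions $0=x_0<x_1<\dots<x_n=1$ of $[0,1]$. Say that $\varphi$ satisfies the Zygmund condition if $\sup_{x\in\mathbb R,\,t\ne0}\bigl|\bigl(\varphi(x+t)+\varphi(x-t)-2\varphi(x)\bigr)/t\bigr|<\infty$. A wandering interval of $f$ is a nondegenerate arc $J\subset S^1$ whose iterates $f^n(J)$ are pairwise disjoint. (1) If the rotation number $\alpha=\lim_{n\to\infty}(F^n(x)-x)/n$ (mod $1$) of $f$ is irrational and $\log f'$ has bounded Zygmund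 variation and bounded quadratic variation, then $f$ has no wandering interval, and $f$ is topologically conjugate to the irrational rigid rotation $x\mapsto x+\alpha$ of $\mathbb R/\mathbb Z$. (2) This criterion is weaker than Denjoy's condition and than the Zygmund condition: if $\log f'$ is of bounded variation on $[0,1]$, or if $\log f'$ satisfies the Zygmund condition, then $\log f'$ has bounded Zygmund variation and bounded quadratic variation. It is strictly weaker than each of them: there is an orientation-preserving $C^1$ circle diffeomorphism with irrational rotation number for which $\log f'$ is of bounded variation but does not satisfy the Zygmund condition, and there is another one for which $\log f'$ satisfies the Zygmund condition but is not of bounded variation. -/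

import Mathlib

/-- `F` is a (continuous, monotone, degree one) lift to `ℝ` of the circle map `f`, where the
circle is `ℝ / ℤ`.  A homeomorphism of the circle has such a lift exactly when it preserves the
orientation, and the lift is then unique up to adding an integer.  The rotation number of `f` is
the class mod 1 of `F.translationNumber`, the limit of `(F^[n] x - x) / n`. -/
structure IsCircleLift (F : CircleDeg1Lift) (f : UnitAddCircle ≃ₜ UnitAddCircle) : Prop where
  continuous : Continuous F
  semiconj : ∀ x : ℝ, ((F x : ℝ) : UnitAddCircle) = f (x : UnitAddCircle)

/-- `f` is an orientation-preserving `C¹` diffeomorphism of the circle, with lift `F`: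
the lift is `C¹` and its derivative (which is the derivative of `f`) is everywhere positive. -/
structure IsCircleC1Diffeo (F : CircleDeg1Lift) (f : UnitAddCircle ≃ₜ UnitAddCircle) : Prop where
  lift : IsCircleLift F f
  contDiff : ContDiff ℝ 1 F
  deriv_pos : ∀ x : ℝ, 0 < deriv F x

/-- The function `log f'` on the circle, written as a 1-periodic function on `ℝ`. -/
noncomputable def logOfDeriv (F : CircleDeg1Lift) : ℝ → ℝ := fun x => Real.log (deriv F x)

/-- `x 0 < x 1 < ⋯ < x n` is a partition of the interval `[a, b]`. -/
structure IsPartition (a b : ℝ) (n : ℕ) (x : ℕ → ℝ) : Prop where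
  left : x 0 = a
  right : x n = b
  lt_succ : ∀ i < n, x i < x (i + 1)

/-- `φ` is continuous and of bounded Zygmund variation on `[a, b]`. -/
def HasBoundedZygmundVariation (φ : ℝ → ℝ) (a b : ℝ) : Prop :=
  ContinuousOn φ (Set.Icc a b) ∧
  ∃ B : ℝ, 0 < B ∧ ∀ (n : ℕ) (x : ℕ → ℝ), IsPartition a b n x →
    ∑ i ∈ Finset.range n, |φ (x i) + φ (x (i + 1)) - 2 * φ ((x i + x (i + 1)) / 2)| ≤ B

/-- `φ` is continuous and of bounded quadratic variation on `[a, b]`: the sums of squared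
increments are bounded over all partitions. -/
def HasBoundedQuadraticVariation (φ : ℝ → ℝ) (a b : ℝ) : Prop :=
  ContinuousOn φ (Set.Icc a b) ∧
  ∃ B : ℝ, 0 < B ∧ ∀ (n : ℕ) (x : ℕ → ℝ), IsPartition a b n x →
    ∑ i ∈ Finset.range n, (φ (x (i + 1)) - φ (x i)) ^ 2 ≤ B

/-- The Zygmund condition for a continuous function on the line. -/
def ZygmundCondition (φ : ℝ → ℝ) : Prop :=
  Continuous φ ∧
  ∃ B : ℝ, 0 < B ∧ ∀ x t : ℝ, t ≠ 0 → |(φ (x + t) + φ (x - t) - 2 * φ x) / t| ≤ B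

/-- `J` is a wandering interval of `f`: a nondegenerate arc of the circle (open, closed or
half-open) whose iterates are pairwise disjoint.  As `f` is bijective, disjointness
of the forward iterates is the same as disjointness of all iterates. -/
def IsWanderingInterval (f : UnitAddCircle ≃ₜ UnitAddCircle) (J : Set UnitAddCircle) : Prop :=
  (∃ I : Set ℝ, I.OrdConnected ∧ I.Nontrivial ∧ J = (fun x : ℝ => (x : UnitAddCircle)) '' I) ∧
  ∀ m n : ℕ, m ≠ n → Disjoint (f^[m] '' J) (f^[n] '' J)

/-- `f` is topologically conjugate to the rigid rotation `x ↦ x + α` of `ℝ / ℤ`. -/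
def IsConjugateToRotation (f : UnitAddCircle ≃ₜ UnitAddCircle) (α : ℝ) : Prop :=
  ∃ h : UnitAddCircle ≃ₜ UnitAddCircle, ∀ x : UnitAddCircle, h (f x) = h x + (α : UnitAddCircle)

/-! The criterion is a cross-ratio version of Denjoy's argument. Put φ = log F'. Averaging exp φ
over an interval with its reflection about the midpoint shows that `F` stretches the interval by exp
φ(midpoint), up to a factor governed by second differences and squared increments of φ. For a < b <
c < d the midpoints of [a,d], [b,c] and those of [a,b], [c,d] have the same centre, so φ itself
cancels from the distortion of the cross ratio (`crossRatio_le_mul_crossRatio`). Both variations are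
packed into the increments of one monotone `w`, which plays the role of the total variation of φ.

Suppose a continuous semiconjugacy `H` to the rotation collapses an interval J. At a closest return
time q, take the shortest of the first q iterates of J. Its neighbours on both sides are at least as
long, so the cross ratio they span is at most 3. Pulling it back to J costs a bounded factor,
because the intervals involved have bounded multiplicity (`exists_sum_increments_le`). The gap to
the left of J is then bounded below, yet it must shrink as the returns get closer. So `H` is
injective (`injective_of_semiconj`), which gives the conjugacy and excludes wandering intervals.

Bounded variation and the Zygmund condition each dominate both sums by increments of a function; the
Zygmund case passes through a Hölder 1/2 bound. For strictness, any continuous periodic φ is log F'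
up to a constant, with irrational rotation number, so a cusp and a lacunary cosine series suffice.
-/

theorem UnitAddCircle.coe_eq_coe_iff {x y : ℝ} :
    (x : UnitAddCircle) = y ↔ ∃ n : ℤ, x = y + n := by
  rw [← sub_eq_zero, ← AddCircle.coe_sub, AddCircle.coe_eq_zero_iff]
  refine exists_congr fun n => ?_
  simp only [zsmul_eq_mul, mul_one]
  constructor <;> intro h <;> linarith

/-- A strictly monotone continuous degree one map of the line descends to a homeomorphism of the
circle. -/
theorem CircleDeg1Lift.exists_homeomorph (F : CircleDeg1Lift) (hc : Continuous F)
    (hs : StrictMono F) :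
    ∃ f : UnitAddCircle ≃ₜ UnitAddCircle,
      ∀ x : ℝ, ((F x : ℝ) : UnitAddCircle) = f (x : UnitAddCircle) := by
  have hp : Function.Periodic (fun x : ℝ => ((F x : ℝ) : UnitAddCircle)) 1 := fun x => by
    simp
  let g : UnitAddCircle → UnitAddCircle := hp.lift
  have hg : ∀ x : ℝ, g (x : UnitAddCircle) = ((F x : ℝ) : UnitAddCircle) := fun x => hp.lift_coe x
  have hgc : Continuous g := by
    refine continuous_coinduced_dom.2 ?_
    exact (AddCircle.continuous_mk' 1).comp hc
  have hinj : Function.Injective g := by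
    intro x y
    induction x using QuotientAddGroup.induction_on with | H x => ?_
    induction y using QuotientAddGroup.induction_on with | H y => ?_
    intro h
    change g (x : UnitAddCircle) = g (y : UnitAddCircle) at h
    rw [hg, hg, UnitAddCircle.coe_eq_coe_iff] at h
    obtain ⟨n, hn⟩ := h
    rw [← F.map_add_int] at hn
    exact UnitAddCircle.coe_eq_coe_iff.2 ⟨n, hs.injective hn⟩
  have hsurj : Function.Surjective g := by
    intro y
    induction y using QuotientAddGroup.induction_on with | H y => ?_
    obtain ⟨x, rfl⟩ := F.continuous_iff_surjective.1 hc y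
    exact ⟨x, hg x⟩
  let e : UnitAddCircle ≃ UnitAddCircle := Equiv.ofBijective g ⟨hinj, hsurj⟩
  have he : Continuous e := hgc
  exact ⟨he.homeoOfEquivCompactToT2, fun x => (hg x).symm⟩

/-! ### Partition sums and dominating functions. -/

theorem IsPartition.append {a u v : ℝ} {n : ℕ} {p : ℕ → ℝ} (hp : IsPartition a u n p)
    (huv : u < v) : IsPartition a v (n + 1) (fun i => if i ≤ n then p i else v) where
  left := by simp [hp.left]
  right := by simp
  lt_succ i hi := by
    rcases Nat.lt_succ_iff_lt_or_eq.1 hi with h | rfl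
    · have h1 : i + 1 ≤ n := h
      simpa [h1, h.le] using hp.lt_succ i h
    · simpa [hp.right] using huv

theorem IsPartition.sum_append {a u : ℝ} {n : ℕ} {p : ℕ → ℝ} (hp : IsPartition a u n p) (v : ℝ)
    (ρ : ℝ → ℝ → ℝ) :
    ∑ i ∈ Finset.range (n + 1), ρ (if i ≤ n then p i else v) (if i + 1 ≤ n then p (i + 1) else v) =
      ∑ i ∈ Finset.range n, ρ (p i) (p (i + 1)) + ρ u v := by
  rw [Finset.sum_range_succ]
  congr 1
  · refine Finset.sum_congr rfl fun i hi => ?_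
    have h := Finset.mem_range.1 hi
    have h1 : i + 1 ≤ n := h
    simp [h1, h.le]
  · simp [hp.right]

theorem IsPartition.mem_Icc {a b : ℝ} {n : ℕ} {x : ℕ → ℝ} (hx : IsPartition a b n x) {i : ℕ}
    (hi : i ≤ n) : x i ∈ Set.Icc a b := by
  have hm : ∀ j k, j ≤ k → k ≤ n → x j ≤ x k := by
    intro j k hjk
    induction k, hjk using Nat.le_induction with
    | base => intro _; exact le_rfl
    | succ k _ ih => intro hk; exact (ih (by omega)).trans (hx.lt_succ k (by omega)).le
  exact ⟨hx.left ▸ hm 0 i (Nat.zero_le _) hi, hx.right ▸ hm i n hi le_rfl⟩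

/-- Sums over partitions of an interval function dominated by the increments of `w`. -/
theorem IsPartition.sum_le {a b : ℝ} {n : ℕ} {x : ℕ → ℝ} (hx : IsPartition a b n x)
    {ρ : ℝ → ℝ → ℝ} {w : ℝ → ℝ}
    (h : ∀ u ∈ Set.Icc a b, ∀ v ∈ Set.Icc a b, u < v → ρ u v ≤ w v - w u) :
    ∑ i ∈ Finset.range n, ρ (x i) (x (i + 1)) ≤ w b - w a := by
  calc _ ≤ ∑ i ∈ Finset.range n, (w (x (i + 1)) - w (x i)) := by
        refine Finset.sum_le_sum fun i hi => ?_
        have hi := Finset.mem_range.1 hi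
        exact h _ (hx.mem_Icc hi.le) _ (hx.mem_Icc hi) (hx.lt_succ i hi)
    _ = w b - w a := by rw [Finset.sum_range_sub (fun i => w (x i)), hx.left, hx.right]

/-- If the sums of a nonnegative interval function over the partitions of `[0, 1]` are bounded,
then it is dominated on `[0, 1]` by the increments of a bounded function. -/
theorem exists_dominating_function {ρ : ℝ → ℝ → ℝ} {B : ℝ}
    (hB : ∀ (n : ℕ) (x : ℕ → ℝ), IsPartition 0 1 n x →
      ∑ i ∈ Finset.range n, ρ (x i) (x (i + 1)) ≤ B) (h0 : ∀ u v, 0 ≤ ρ u v) :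
    ∃ w : ℝ → ℝ, (∀ x ∈ Set.Icc (0 : ℝ) 1, w x ∈ Set.Icc 0 B) ∧
      ∀ u v, 0 ≤ u → u < v → v ≤ 1 → ρ u v ≤ w v - w u := by
  -- The dominating function is the supremum of the sums over partitions of [0, x]; appending v to a
  -- partition of [0, u] adds exactly `ρ u v`.
  let S : ℝ → Set ℝ := fun x => {s | ∃ (n : ℕ) (p : ℕ → ℝ), IsPartition 0 x n p ∧
    s = ∑ i ∈ Finset.range n, ρ (p i) (p (i + 1))}
  have hS : ∀ u v s, u < v → s ∈ S u → s + ρ u v ∈ S v := by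
    rintro u v _ huv ⟨n, p, hp, rfl⟩
    exact ⟨n + 1, _, hp.append huv, (hp.sum_append v ρ).symm⟩
  have hle : ∀ x ≤ 1, ∀ s ∈ S x, s ≤ B := by
    intro x hx s hs
    rcases hx.lt_or_eq with h | rfl
    · obtain ⟨n, p, hp, hs'⟩ := hS x 1 s h hs
      have := hB n p hp
      linarith [h0 x 1]
    · obtain ⟨n, p, hp, rfl⟩ := hs
      exact hB n p hp
  have hzero : (0 : ℝ) ∈ S 0 := ⟨0, fun _ => 0, ⟨rfl, rfl, by simp⟩, by simp⟩
  have hne : ∀ x, 0 ≤ x → ∃ s ∈ S x, 0 ≤ s := by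
    intro x hx
    rcases hx.lt_or_eq with h | rfl
    · exact ⟨_, hS 0 x 0 h hzero, by simpa using h0 0 x⟩
    · exact ⟨0, hzero, le_rfl⟩
  have hbdd : ∀ x ≤ 1, BddAbove (S x) := fun x hx => ⟨B, fun s hs => hle x hx s hs⟩
  refine ⟨fun x => sSup (S x), fun x hx => ?_, fun u v hu huv hv => ?_⟩
  · obtain ⟨s, hs, hs0⟩ := hne x hx.1
    exact ⟨hs0.trans (le_csSup (hbdd x hx.2) hs), csSup_le ⟨s, hs⟩ (hle x hx.2)⟩
  · obtain ⟨s, hs, -⟩ := hne u hu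
    have : sSup (S u) ≤ sSup (S v) - ρ u v := csSup_le ⟨s, hs⟩ fun t ht => by
      linarith [le_csSup (hbdd v hv) (hS u v t huv ht)]
    show ρ u v ≤ sSup (S v) - sSup (S u)
    linarith

/-- The periodic version of `exists_dominating_function`. -/
theorem exists_monotone_dominating_function {ρ : ℝ → ℝ → ℝ} {B C : ℝ}
    (hB : ∀ (n : ℕ) (x : ℕ → ℝ), IsPartition 0 1 n x →
      ∑ i ∈ Finset.range n, ρ (x i) (x (i + 1)) ≤ B) (h0 : ∀ u v, 0 ≤ ρ u v)
    (hC : ∀ u v, ρ u v ≤ C) (hper : ∀ u v (n : ℤ), ρ (u + n) (v + n) = ρ u v) :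
    ∃ w : ℝ → ℝ, Monotone w ∧ (∀ x y (n : ℤ), w (x + n) - w (y + n) = w x - w y) ∧
      ∀ u v, u < v → ρ u v ≤ w v - w u := by
  obtain ⟨w, hw, hρ⟩ := exists_dominating_function hB h0
  -- The jump B + C at each integer pays for a drop of `w` by at most B between periods and for `ρ`
  -- ≤ C.
  have key : ∀ u v, u < v → ρ u v ≤ (w (Int.fract v) + (B + C) * ⌊v⌋) -
      (w (Int.fract u) + (B + C) * ⌊u⌋) := by
    intro u v huv
    have hwu := hw (Int.fract u) ⟨Int.fract_nonneg u, (Int.fract_lt_one u).le⟩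
    have hwv := hw (Int.fract v) ⟨Int.fract_nonneg v, (Int.fract_lt_one v).le⟩
    rcases (Int.floor_le_floor huv.le).eq_or_lt with h | h
    · have h1 := hper (Int.fract u) (Int.fract v) ⌊u⌋
      rw [Int.fract_add_floor, h, Int.fract_add_floor] at h1
      rw [h1]
      have h2 : Int.fract u < Int.fract v := by
        rw [Int.fract, Int.fract, h]; linarith
      have := hρ _ _ (Int.fract_nonneg u) h2 (Int.fract_lt_one v).le
      rw [h]; linarith
    · have h1 : (⌊u⌋ : ℝ) + 1 ≤ ⌊v⌋ := by exact_mod_cast h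
      have h2 := hC u v
      have h3 := h0 u v
      have h4 : 0 ≤ B := hwu.1.trans hwu.2
      have h5 : (B + C) * (⌊u⌋ + 1) ≤ (B + C) * ⌊v⌋ := by gcongr; linarith
      linarith [hwu.2, hwv.1]
  refine ⟨fun x => w (Int.fract x) + (B + C) * ⌊x⌋, ?_, ?_, key⟩
  · intro u v huv
    rcases huv.eq_or_lt with rfl | h
    · exact le_rfl
    · have := key u v h
      have := h0 u v
      show w (Int.fract u) + (B + C) * ⌊u⌋ ≤ w (Int.fract v) + (B + C) * ⌊v⌋
      linarith
  · intro x y n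
    simp only [Int.fract_add_intCast, Int.floor_add_intCast]
    push_cast
    ring

/-! ### Closest returns of an irrational rotation. -/

section RotationOrbits

theorem Irrational.abs_mul_sub_pos {α : ℝ} (hα : Irrational α) {k : ℕ} (hk : 0 < k) (n : ℤ) :
    0 < |k * α - n| := by
  rw [abs_pos, sub_ne_zero]
  exact (hα.natCast_mul hk.ne').ne_int n

theorem Irrational.exists_abs_mul_sub_lt (α : ℝ) {ε : ℝ} (hε : 0 < ε) :
    ∃ k : ℕ, 0 < k ∧ ∃ n : ℤ, |k * α - n| < ε := by
  obtain ⟨N, hN⟩ := exists_nat_one_div_lt hε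
  obtain ⟨k, hk, -, h⟩ := Real.exists_nat_abs_mul_sub_round_le α (Nat.succ_pos N)
  refine ⟨k, hk, _, h.trans_lt (lt_of_le_of_lt ?_ hN)⟩
  push_cast
  gcongr
  linarith

/-- At a time `q` of closest return, the orbit segment `0, …, q - 1` of an irrational rotation is
separated by some small `δ`, and each of its points has neighbours at distance less than `2δ`
on both sides. -/
theorem Irrational.exists_separated_orbit {α : ℝ} (hα : Irrational α) {ε : ℝ} (hε : 0 < ε) :
    ∃ (q : ℕ) (δ : ℝ), 0 < q ∧ 0 < δ ∧ δ < ε ∧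
      (∀ i < q, ∀ k < q, i ≠ k → ∀ n : ℤ, δ ≤ |((i : ℝ) - k) * α - n|) ∧
      (∀ i < q, ∃ j < q, ∃ n : ℤ, 0 < ((j : ℝ) - i) * α + n ∧ ((j : ℝ) - i) * α + n < 2 * δ) ∧
      (∀ i < q, ∃ j < q, ∃ n : ℤ, 0 < ((i : ℝ) - j) * α + n ∧ ((i : ℝ) - j) * α + n < 2 * δ) := by
  obtain ⟨k₀, hk₀, n₀, hn₀⟩ := Irrational.exists_abs_mul_sub_lt α hε
  let d : ℕ → ℝ := fun k => |k * α - round (k * α)|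
  have hd : ∀ (k : ℕ) (n : ℤ), d k ≤ |k * α - n| := fun k n => round_le _ n
  -- q' minimises `d` up to k₀, which makes δ = d q' smaller than ε; q below is the first time to
  -- improve on q', so no earlier time returns closer than δ.
  obtain ⟨q', hq', hmin⟩ := Finset.exists_min_image (Finset.Icc 1 k₀) d
    ⟨k₀, Finset.mem_Icc.2 ⟨hk₀, le_rfl⟩⟩
  rw [Finset.mem_Icc] at hq'
  have hδ : 0 < d q' := hα.abs_mul_sub_pos hq'.1 _
  have hex : ∃ k : ℕ, 0 < k ∧ d k < d q' := by
    obtain ⟨k, hk, n, hn⟩ := Irrational.exists_abs_mul_sub_lt α hδ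
    exact ⟨k, hk, (hd k n).trans_lt hn⟩
  classical
  obtain ⟨q, ⟨hq, hdq⟩, hqmin⟩ : ∃ q, (0 < q ∧ d q < d q') ∧ ∀ k < q, ¬ (0 < k ∧ d k < d q') :=
    ⟨Nat.find hex, Nat.find_spec hex, fun k hk => Nat.find_min hex hk⟩
  have hqq : q' < q := by
    by_contra h
    exact absurd (hmin q (Finset.mem_Icc.2 ⟨hq, by omega⟩)) (not_le.2 hdq)
  have hsep : ∀ k < q, 0 < k → ∀ n : ℤ, d q' ≤ |k * α - n| := by
    intro k hk hk0 n
    by_contra! h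
    exact hqmin k hk ⟨hk0, (hd k n).trans_lt h⟩
  have hsign : ∀ i < q, ∀ k < q, i ≠ k → ∀ n : ℤ, d q' ≤ |((i : ℝ) - k) * α - n| := by
    intro i hi k hk hik n
    rcases lt_or_gt_of_ne hik with h | h
    · have := hsep (k - i) (by omega) (by omega) (-n)
      rw [Nat.cast_sub h.le, ← abs_neg] at this
      convert this using 2
      push_cast; ring
    · have := hsep (i - k) (by omega) (by omega) n
      rwa [Nat.cast_sub h.le] at this
  set p' := round (q' * α) with hp'
  set p := round (q * α) with hp
  have hs : d q' = |q' * α - p'| := rfl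
  have ht : |q * α - p| < |q' * α - p'| := hdq
  set s : ℝ := q' * α - p' with hs'
  set t : ℝ := q * α - p with ht'
  -- The time i + q', or i + q' - q if that is too late, displaces by s or s - t. As |t| < |s|, both
  -- have the sign of s and size below 2|s|. The sign of s decides which of `hplus` and `hminus`
  -- gives the right neighbour.
  have hplus : ∀ i < q, ∃ j < q, ∃ n : ℤ,
      ((j : ℝ) - i) * α + n = s ∨ ((j : ℝ) - i) * α + n = s - t := by
    intro i hi
    by_cases h : i + q' < q
    · exact ⟨i + q', h, -p', Or.inl (by push_cast; ring)⟩
    · refine ⟨i + q' - q, by omega, p - p', Or.inr ?_⟩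
      rw [Nat.cast_sub (by omega)]; push_cast; ring
  have hminus : ∀ i < q, ∃ j < q, ∃ n : ℤ,
      ((i : ℝ) - j) * α + n = s ∨ ((i : ℝ) - j) * α + n = s - t := by
    intro i hi
    by_cases h : q' ≤ i
    · exact ⟨i - q', by omega, -p', Or.inl (by rw [Nat.cast_sub h]; push_cast; ring)⟩
    · refine ⟨i + q - q', by omega, p - p', Or.inr ?_⟩
      rw [Nat.cast_sub (by omega)]; push_cast; ring
  have hdε : d q' < ε := (hmin k₀ (Finset.mem_Icc.2 ⟨hk₀, le_rfl⟩)).trans_lt ((hd k₀ n₀).trans_lt hn₀)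
  refine ⟨q, d q', hq, hδ, hdε, hsign, ?_, ?_⟩
  all_goals
    intro i hi
    obtain ⟨j, hj, n, hn⟩ := hplus i hi
    obtain ⟨j', hj', n', hn'⟩ := hminus i hi
    rw [hs] at hδ ⊢
    rcases abs_cases s with ⟨h1, h2⟩ | ⟨h1, h2⟩
  · refine ⟨j, hj, n, ?_⟩
    have := abs_lt.1 ht
    rw [h1] at *
    rcases hn with hn | hn <;> rw [hn] <;> constructor <;> linarith
  · refine ⟨j', hj', -n', ?_⟩
    have := abs_lt.1 ht
    rw [h1] at *
    have e : ((j' : ℝ) - i) * α + ((-n' : ℤ) : ℝ) = -((i - j') * α + n') := by push_cast; ring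
    rw [e]
    rcases hn' with hn | hn <;> rw [hn] <;> constructor <;> linarith
  · refine ⟨j', hj', n', ?_⟩
    have := abs_lt.1 ht
    rw [h1] at *
    rcases hn' with hn | hn <;> rw [hn] <;> constructor <;> linarith
  · refine ⟨j, hj, -n, ?_⟩
    have := abs_lt.1 ht
    rw [h1] at *
    have e : ((i : ℝ) - j) * α + ((-n : ℤ) : ℝ) = -((j - i) * α + n) := by push_cast; ring
    rw [e]
    rcases hn with hn | hn <;> rw [hn] <;> constructor <;> linarith

end RotationOrbits

/-! ### Distortion of cross ratios. -/

section CrossRatio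

/-- The integral of `exp ∘ φ` over an interval is controlled by the value of `φ` at the midpoint,
the symmetric second differences and the squared symmetric increments. -/
theorem integral_exp_mem_Icc {φ : ℝ → ℝ} (hφ : Continuous φ) {b c Δ : ℝ} (hbc : b ≤ c)
    (h : ∀ x ∈ Set.Icc b c, |φ x + φ (b + c - x) - 2 * φ ((b + c) / 2)| ≤ Δ ∧
      (φ x - φ (b + c - x)) ^ 2 ≤ Δ) :
    ∫ x in b..c, Real.exp (φ x) ∈ Set.Icc ((c - b) * Real.exp (φ ((b + c) / 2) - Δ))
      ((c - b) * Real.exp (φ ((b + c) / 2) + Δ)) := by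
  set M := φ ((b + c) / 2) with hM
  have hsymm : ∫ x in b..c, Real.exp (φ (b + c - x)) = ∫ x in b..c, Real.exp (φ x) := by
    rw [intervalIntegral.integral_comp_sub_left (fun x => Real.exp (φ x)) (b + c)]
    congr 1 <;> ring
  have hc1 : Continuous fun x => Real.exp (φ x) := by fun_prop
  have hc2 : Continuous fun x => Real.exp (φ (b + c - x)) := by fun_prop
  have havg : ∫ x in b..c, Real.exp (φ x) =
      ∫ x in b..c, (Real.exp (φ x) + Real.exp (φ (b + c - x))) / 2 := by
    rw [intervalIntegral.integral_div, intervalIntegral.integral_add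
      (hc1.intervalIntegrable _ _) (hc2.intervalIntegrable _ _), hsymm]
    ring
  have hpt : ∀ x ∈ Set.Icc b c,
      Real.exp (M - Δ) ≤ (Real.exp (φ x) + Real.exp (φ (b + c - x))) / 2 ∧
      (Real.exp (φ x) + Real.exp (φ (b + c - x))) / 2 ≤ Real.exp (M + Δ) := by
    intro x hx
    obtain ⟨h1, h2⟩ := h x hx
    rw [abs_le] at h1
    have hΔ : 0 ≤ Δ := (sq_nonneg _).trans h2
    set p := φ x
    set r := φ (b + c - x)
    -- The second difference controls (p + r)/2, and the squared increment controls cosh through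
    -- cosh y ≤ exp(y²/2).
    have e : (Real.exp p + Real.exp r) / 2 = Real.exp ((p + r) / 2) * Real.cosh ((p - r) / 2) := by
      rw [Real.cosh_eq, ← mul_div_assoc, mul_add, ← Real.exp_add, ← Real.exp_add]
      congr 3 <;> ring_nf
    rw [e]
    constructor
    · calc Real.exp (M - Δ) ≤ Real.exp ((p + r) / 2) * 1 := by
            rw [mul_one]; exact Real.exp_le_exp.2 (by linarith)
        _ ≤ _ := by gcongr; exact Real.one_le_cosh _
    · calc Real.exp ((p + r) / 2) * Real.cosh ((p - r) / 2)
          ≤ Real.exp ((p + r) / 2) * Real.exp (((p - r) / 2) ^ 2 / 2) := by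
            gcongr; exact Real.cosh_le_exp_half_sq _
        _ ≤ _ := by
            rw [← Real.exp_add]
            exact Real.exp_le_exp.2 (by nlinarith)
  have hc3 : Continuous fun x => (Real.exp (φ x) + Real.exp (φ (b + c - x))) / 2 := by fun_prop
  rw [havg]
  constructor
  · have := intervalIntegral.integral_mono_on (μ := MeasureTheory.volume) hbc
      (intervalIntegrable_const (c := Real.exp (M - Δ)))
      (hc3.intervalIntegrable b c) (fun x hx => (hpt x hx).1)
    simpa using this
  · have := intervalIntegral.integral_mono_on (μ := MeasureTheory.volume) hbc
      (hc3.intervalIntegrable b c)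
      (intervalIntegrable_const (c := Real.exp (M + Δ))) (fun x hx => (hpt x hx).2)
    simpa using this

/-- The cross ratio of four points of the line. -/
noncomputable def crossRatio (a b c d : ℝ) : ℝ := (d - a) * (c - b) / ((b - a) * (d - c))

/-- With successive lengths L, M, R the cross ratio is M/L + M/R + M²/(LR). -/
theorem crossRatio_le_three {a b c d : ℝ} (hbc : b < c) (h1 : c - b ≤ b - a) (h2 : c - b ≤ d - c) :
    crossRatio a b c d ≤ 3 := by
  rw [crossRatio, div_le_iff₀ (mul_pos (by linarith) (by linarith))]
  nlinarith [mul_nonneg (sub_nonneg.2 h1) (sub_nonneg.2 h2)]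

/-- Turns an upper bound on the cross ratio into a lower bound on the gap b - a. -/
theorem div_le_crossRatio {a b c d : ℝ} (hab : a < b) (hbc : b < c) (hcd : c < d) :
    (c - b) / (b - a) ≤ crossRatio a b c d := by
  rw [crossRatio, div_le_div_iff₀ (by linarith) (mul_pos (by linarith) (by linarith))]
  have : 0 ≤ (c - b) * (b - a) * (c - a) := by
    apply mul_nonneg (mul_nonneg _ _) <;> linarith
  nlinarith

variable {F : CircleDeg1Lift} {w : ℝ → ℝ}

theorem continuous_logOfDeriv (hF : ContDiff ℝ 1 F) (hpos : ∀ x, 0 < deriv F x) :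
    Continuous (logOfDeriv F) :=
  (hF.continuous_deriv le_rfl).log fun x => (hpos x).ne'

theorem CircleDeg1Lift.deriv_add_int (F : CircleDeg1Lift) (x : ℝ) (n : ℤ) :
    deriv F (x + n) = deriv F x := by
  have h : (fun y => F (y + n)) = fun y => F y + n := funext fun y => F.map_add_int y n
  rw [← deriv_comp_add_const, h, deriv_add_const]

theorem logOfDeriv_add_int (F : CircleDeg1Lift) (x : ℝ) (n : ℤ) :
    logOfDeriv F (x + n) = logOfDeriv F x := by
  rw [logOfDeriv, logOfDeriv, F.deriv_add_int]

theorem map_sub_eq_integral (hF : ContDiff ℝ 1 F) (hpos : ∀ x, 0 < deriv F x) (b c : ℝ) :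
    F c - F b = ∫ x in b..c, Real.exp (logOfDeriv F x) := by
  have h : (fun x => Real.exp (logOfDeriv F x)) = deriv F :=
    funext fun x => Real.exp_log (hpos x)
  rw [h, intervalIntegral.integral_deriv_eq_sub
    (fun x _ => (hF.differentiable one_ne_zero).differentiableAt)
    ((hF.continuous_deriv le_rfl).intervalIntegrable _ _)]

/-- One application of a diffeomorphism decreases cross ratios by a factor controlled by the second
differences and the squared increments of the logarithm of its derivative. -/
theorem crossRatio_le_mul_crossRatio (hF : ContDiff ℝ 1 F) (hpos : ∀ x, 0 < deriv F x)
    (hw : Monotone w) (hφ : ∀ u v, u < v → |logOfDeriv F u + logOfDeriv F v -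
      2 * logOfDeriv F ((u + v) / 2)| + (logOfDeriv F v - logOfDeriv F u) ^ 2 ≤ w v - w u)
    {a b c d : ℝ} (hab : a < b) (hbc : b < c) (hcd : c < d) :
    crossRatio a b c d ≤ Real.exp (6 * (w d - w a)) * crossRatio (F a) (F b) (F c) (F d) := by
  set Δ := w d - w a with hΔ
  set φ := logOfDeriv F with hφdef
  have hφc : Continuous φ := continuous_logOfDeriv hF hpos
  have hΔ0 : 0 ≤ Δ := sub_nonneg.2 (hw (by linarith))
  have hlocal : ∀ u ∈ Set.Icc a d, ∀ v ∈ Set.Icc a d,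
      |φ u + φ v - 2 * φ ((u + v) / 2)| ≤ Δ ∧ (φ u - φ v) ^ 2 ≤ Δ := by
    have hlt : ∀ u ∈ Set.Icc a d, ∀ v ∈ Set.Icc a d, u < v →
        |φ u + φ v - 2 * φ ((u + v) / 2)| ≤ Δ ∧ (φ u - φ v) ^ 2 ≤ Δ := by
      intro u hu v hv huv
      have h1 := hφ u v huv
      have h2 := hw hu.1
      have h3 := hw hv.2
      have h4 := abs_nonneg (φ u + φ v - 2 * φ ((u + v) / 2))
      have h5 := sq_nonneg (φ v - φ u)
      constructor
      · linarith
      · rw [sub_sq_comm]; linarith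
    intro u hu v hv
    rcases lt_trichotomy u v with h | rfl | h
    · exact hlt u hu v hv h
    · have e : (u + u) / 2 = u := by ring
      rw [e]
      constructor
      · rw [show φ u + φ u - 2 * φ u = 0 by ring, abs_zero]; exact hΔ0
      · simpa using hΔ0
    · have := hlt v hv u hu h
      rwa [add_comm (φ u), add_comm u, sub_sq_comm]
  have hS : ∀ x y, a ≤ x → x < y → y ≤ d → F y - F x ∈
      Set.Icc ((y - x) * Real.exp (φ ((x + y) / 2) - Δ))
        ((y - x) * Real.exp (φ ((x + y) / 2) + Δ)) := by
    intro x y hx hxy hy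
    rw [map_sub_eq_integral hF hpos]
    refine integral_exp_mem_Icc hφc hxy.le fun z hz => ?_
    have := hlocal z ⟨hx.trans hz.1, hz.2.trans hy⟩ (x + y - z)
      ⟨by linarith [hz.2], by linarith [hz.1]⟩
    rwa [show z + (x + y - z) = x + y by ring] at this
  have had := (hS a d le_rfl (by linarith) le_rfl).1
  have hbc' := (hS b c hab.le hbc hcd.le).1
  have hab' := (hS a b le_rfl hab (by linarith)).2
  have hcd' := (hS c d (by linarith) hcd le_rfl).2
  have hab0 := (hS a b le_rfl hab (by linarith)).1
  have hcd0 := (hS c d (by linarith) hcd le_rfl).1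
  -- Both pairs of midpoints are centred at (a + b + c + d)/4, so both sums of φ equal twice its
  -- value there up to Δ. These two errors and the four from `hS` make the 6.
  have m1 := (abs_le.1 (hlocal ((a + d) / 2) ⟨by linarith, by linarith⟩ ((b + c) / 2)
    ⟨by linarith, by linarith⟩).1).1
  have m2 := (abs_le.1 (hlocal ((a + b) / 2) ⟨by linarith, by linarith⟩ ((c + d) / 2)
    ⟨by linarith, by linarith⟩).1).2
  rw [show ((a + d) / 2 + (b + c) / 2) = ((a + b) / 2 + (c + d) / 2) by ring] at m1
  have pab : 0 < F b - F a := lt_of_lt_of_le (mul_pos (by linarith) (Real.exp_pos _)) hab0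
  have pcd : 0 < F d - F c := lt_of_lt_of_le (mul_pos (by linarith) (Real.exp_pos _)) hcd0
  have pad : 0 < d - a := by linarith
  have pbc : 0 < c - b := by linarith
  have qab : 0 < b - a := by linarith
  have qcd : 0 < d - c := by linarith
  set A := φ ((a + d) / 2)
  set B := φ ((b + c) / 2)
  set C := φ ((a + b) / 2)
  set D := φ ((c + d) / 2)
  have hlow : ((d - a) * Real.exp (A - Δ)) * ((c - b) * Real.exp (B - Δ)) /
      (((b - a) * Real.exp (C + Δ)) * ((d - c) * Real.exp (D + Δ))) ≤
      crossRatio (F a) (F b) (F c) (F d) := by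
    rw [crossRatio]
    have pad' : 0 ≤ F d - F a := (mul_pos pad (Real.exp_pos _)).le.trans had
    have pbc' : 0 ≤ F c - F b := (mul_pos pbc (Real.exp_pos _)).le.trans hbc'
    have := mul_nonneg pad' pbc'
    gcongr
  refine le_trans ?_ (mul_le_mul_of_nonneg_left hlow (Real.exp_pos _).le)
  have e : Real.exp (6 * Δ) * (((d - a) * Real.exp (A - Δ)) * ((c - b) * Real.exp (B - Δ)) /
      (((b - a) * Real.exp (C + Δ)) * ((d - c) * Real.exp (D + Δ)))) =
      crossRatio a b c d *
        (Real.exp (6 * Δ) * (Real.exp (A - Δ) * Real.exp (B - Δ) /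
          (Real.exp (C + Δ) * Real.exp (D + Δ)))) := by
    rw [crossRatio]; field_simp
  rw [e, ← Real.exp_add, ← Real.exp_add, ← Real.exp_sub, ← Real.exp_add]
  refine le_mul_of_one_le_right (by rw [crossRatio]; positivity) (Real.one_le_exp ?_)
  linarith

theorem crossRatio_le_iterate (hF : ContDiff ℝ 1 F) (hpos : ∀ x, 0 < deriv F x)
    (hw : Monotone w) (hφ : ∀ u v, u < v → |logOfDeriv F u + logOfDeriv F v -
      2 * logOfDeriv F ((u + v) / 2)| + (logOfDeriv F v - logOfDeriv F u) ^ 2 ≤ w v - w u)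
    {a b c d : ℝ} (hab : a < b) (hbc : b < c) (hcd : c < d) (m : ℕ) :
    crossRatio a b c d ≤
      Real.exp (6 * ∑ i ∈ Finset.range m, (w (F^[i] d) - w (F^[i] a))) *
        crossRatio (F^[m] a) (F^[m] b) (F^[m] c) (F^[m] d) := by
  have hmono : StrictMono F := strictMono_of_deriv_pos hpos
  induction m with
  | zero => simp
  | succ m ih =>
    refine ih.trans ?_
    rw [Finset.sum_range_succ, mul_add, Real.exp_add, mul_assoc]
    gcongr
    simp only [Function.iterate_succ_apply']
    exact crossRatio_le_mul_crossRatio hF hpos hw hφ (hmono.iterate m hab) (hmono.iterate m hbc)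
      (hmono.iterate m hcd)

end CrossRatio

/-! ### Injectivity of the semiconjugacy. -/

section NoWanderingIntervals

variable {F H : CircleDeg1Lift} {w : ℝ → ℝ} {α : ℝ}

theorem semiconj_iterate (hH : ∀ x, H (F x) = H x + α) (i : ℕ) (x : ℝ) :
    H (F^[i] x) = H x + i * α := by
  induction i with
  | zero => simp
  | succ i ih => rw [Function.iterate_succ_apply', hH, ih]; push_cast; ring

/-- The sum telescopes to the last five values minus the first five. -/
theorem sum_range_sub_shift_le {y : ℕ → ℝ} (hy : Monotone y) (N : ℕ) :
    ∑ c ∈ Finset.range N, (y (c + 5) - y c) ≤ 5 * (y (N + 4) - y 0) := by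
  have h : ∑ c ∈ Finset.range N, (y (c + 5) - y c) =
      (y N + y (N + 1) + y (N + 2) + y (N + 3) + y (N + 4)) -
        (y 0 + y 1 + y 2 + y 3 + y 4) := by
    induction N with
    | zero => simp
    | succ N ih => rw [Finset.sum_range_succ, ih]; ring
  rw [h]
  have h1 := hy (show N ≤ N + 4 by omega)
  have h2 := hy (show N + 1 ≤ N + 4 by omega)
  have h3 := hy (show N + 2 ≤ N + 4 by omega)
  have h4 := hy (show N + 3 ≤ N + 4 by omega)
  have h5 := hy (show 0 ≤ 1 by omega)
  have h6 := hy (show 0 ≤ 2 by omega)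
  have h7 := hy (show 0 ≤ 3 by omega)
  have h8 := hy (show 0 ≤ 4 by omega)
  linarith

/-- The intervals of a separated orbit segment have bounded multiplicity, hence the increments of
`w` over them have bounded sum. -/
theorem exists_sum_increments_le (hHs : Function.Surjective H) (hH : ∀ x, H (F x) = H x + α)
    (hw : Monotone w) (hwper : ∀ x y (n : ℤ), w (x + n) - w (y + n) = w x - w y) :
    ∃ K : ℝ, ∀ (q : ℕ) (δ : ℝ), 0 < δ → δ < 1 →
      (∀ i < q, ∀ k < q, i ≠ k → ∀ n : ℤ, δ ≤ |((i : ℝ) - k) * α - n|) →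
      ∀ a b d : ℝ, H b - 2 * δ < H a → H d < H b + 2 * δ → ∀ m ≤ q,
        ∑ i ∈ Finset.range m, (w (F^[i] d) - w (F^[i] a)) ≤ K := by
  -- All the intervals, moved into one period, have `H`-image in (-2, 5); this makes the bound
  -- independent of q and δ.
  obtain ⟨g₁, hg₁⟩ := hHs (-2)
  obtain ⟨g₂, hg₂⟩ := hHs 5
  refine ⟨5 * (w g₂ - w g₁), fun q δ hδ hδ1 hsep a b d ha hd m hm => ?_⟩
  choose z hz using fun k : ℕ => hHs (((k : ℝ) - 2) * δ)
  have hlt : ∀ {x y}, H x < H y → x < y := fun h => H.monotone.reflect_lt h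
  have hzm : Monotone z := by
    refine monotone_nat_of_le_succ fun k => (hlt ?_).le
    rw [hz, hz]; push_cast; nlinarith
  have hy : Monotone (w ∘ z) := hw.comp hzm
  -- The circle is cut into cells of length δ, and c i is the cell of the i-th orbit point.
  -- Separation makes c injective. An interval reaching less than 2δ to either side of a point of
  -- cell c has `H`-image within ((c - 2)δ, (c + 3)δ), whence the shift by 2 in `z` and the span 5.
  let p : ℕ → ℝ := fun i => Int.fract (H b + i * α)
  have hp0 : ∀ i, 0 ≤ p i := fun i => Int.fract_nonneg _
  let c : ℕ → ℕ := fun i => ⌊p i / δ⌋₊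
  have hc1 : ∀ i, c i * δ ≤ p i := fun i => by
    rw [← le_div_iff₀ hδ]; exact Nat.floor_le (div_nonneg (hp0 i) hδ.le)
  have hc2 : ∀ i, p i < (c i + 1) * δ := fun i => by
    rw [← div_lt_iff₀ hδ]; exact Nat.lt_floor_add_one _
  have hinj : Set.InjOn c (Finset.range m : Set ℕ) := by
    intro i hi k hk hik
    by_contra hne
    have hi' : i < m := by simpa using hi
    have hk' : k < m := by simpa using hk
    have h := hsep i (by omega) k (by omega) hne (⌊H b + i * α⌋ - ⌊H b + k * α⌋)
    have e : ((i : ℝ) - k) * α - ((⌊H b + i * α⌋ - ⌊H b + k * α⌋ : ℤ) : ℝ) = p i - p k := by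
      simp only [p, Int.fract]; push_cast; ring
    rw [e, le_abs] at h
    have a1 := hc1 i
    have a2 := hc2 i
    have b1 := hc1 k
    have b2 := hc2 k
    rw [hik] at a1 a2
    rcases h with h | h <;> linarith
  have hterm : ∀ i, w (F^[i] d) - w (F^[i] a) ≤ (w ∘ z) (c i + 5) - (w ∘ z) (c i) := by
    intro i
    have e := hwper (F^[i] d) (F^[i] a) (-⌊H b + i * α⌋)
    rw [← e]
    have hp : p i = H b + i * α - ⌊H b + i * α⌋ := rfl
    have h1 : F^[i] d + ((-⌊H b + i * α⌋ : ℤ) : ℝ) ≤ z (c i + 5) := by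
      refine (hlt ?_).le
      rw [H.map_add_int, semiconj_iterate hH, hz]
      push_cast
      linarith [hc2 i]
    have h2 : z (c i) ≤ F^[i] a + ((-⌊H b + i * α⌋ : ℤ) : ℝ) := by
      refine (hlt ?_).le
      rw [H.map_add_int, semiconj_iterate hH, hz]
      push_cast
      linarith [hc1 i]
    have := hw h1
    have := hw h2
    simp only [Function.comp]
    linarith
  set N := ⌊1 / δ⌋₊ + 1 with hN
  have hcN : ∀ i, c i < N := by
    intro i
    refine Nat.lt_succ_of_le (Nat.floor_le_floor ?_)
    gcongr
    exact (Int.fract_lt_one _).le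
  calc ∑ i ∈ Finset.range m, (w (F^[i] d) - w (F^[i] a))
      ≤ ∑ i ∈ Finset.range m, ((w ∘ z) (c i + 5) - (w ∘ z) (c i)) :=
        Finset.sum_le_sum fun i _ => hterm i
    _ = ∑ k ∈ (Finset.range m).image c, ((w ∘ z) (k + 5) - (w ∘ z) k) :=
        (Finset.sum_image (f := fun k => (w ∘ z) (k + 5) - (w ∘ z) k) hinj).symm
    _ ≤ ∑ k ∈ Finset.range N, ((w ∘ z) (k + 5) - (w ∘ z) k) := by
        refine Finset.sum_le_sum_of_subset_of_nonneg ?_ fun k _ _ =>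
          sub_nonneg.2 (hy (by omega))
        intro k hk
        obtain ⟨i, -, rfl⟩ := Finset.mem_image.1 hk
        exact Finset.mem_range.2 (hcN i)
    _ ≤ 5 * ((w ∘ z) (N + 4) - (w ∘ z) 0) := sum_range_sub_shift_le hy N
    _ ≤ 5 * (w g₂ - w g₁) := by
        have h1 : z (N + 4) ≤ g₂ := by
          refine (hlt ?_).le
          have : (⌊1 / δ⌋₊ : ℝ) * δ ≤ 1 := by
            rw [← le_div_iff₀ hδ]; exact Nat.floor_le (by positivity)
          rw [hz, hg₂, hN]; push_cast
          linarith
        have h2 : g₁ ≤ z 0 := by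
          refine (hlt ?_).le
          rw [hz, hg₁]; push_cast
          linarith
        have := hw h1
        have := hw h2
        simp only [Function.comp]
        linarith

/-- A semiconjugacy to an irrational rotation is injective if the logarithm of the derivative has
controlled second differences and squared increments. -/
theorem injective_of_semiconj (hF : ContDiff ℝ 1 F) (hpos : ∀ x, 0 < deriv F x)
    (hα : Irrational α) (hHc : Continuous H) (hH : ∀ x, H (F x) = H x + α)
    (hw : Monotone w) (hwper : ∀ x y (n : ℤ), w (x + n) - w (y + n) = w x - w y)
    (hφ : ∀ u v, u < v → |logOfDeriv F u + logOfDeriv F v -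
      2 * logOfDeriv F ((u + v) / 2)| + (logOfDeriv F v - logOfDeriv F u) ^ 2 ≤ w v - w u) :
    Function.Injective H := by
  have hHs : Function.Surjective H := H.continuous_iff_surjective.1 hHc
  have hFs : Function.Surjective F := F.continuous_iff_surjective.1 hF.continuous
  have hmono : StrictMono F := strictMono_of_deriv_pos hpos
  have hlt : ∀ {x y}, H x < H y → x < y := fun h => H.monotone.reflect_lt h
  refine .of_lt_imp_ne fun x j₁ hxy heq => ?_
  set t := H x with ht
  have hclosed : IsClosed {y | H y = t} := isClosed_eq hHc continuous_const
  obtain ⟨y₀, hy₀⟩ := hHs (t - 1)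
  have hbdd : BddBelow {y | H y = t} := ⟨y₀, fun y hy => (hlt (by
    rw [hy₀, show H y = t from hy]; linarith)).le⟩
  -- Taking the left end of the fibre makes `H` drop strictly below t immediately to the left of j₀.
  set j₀ := sInf {y | H y = t} with hj₀
  have hj₀t : H j₀ = t := hclosed.csInf_mem ⟨x, rfl⟩ hbdd
  have hj : j₀ < j₁ := (csInf_le hbdd rfl).trans_lt hxy
  have hleft : ∀ y < j₀, H y < t := fun y hy => lt_of_le_of_ne (hj₀t ▸ H.monotone hy.le)
    fun h => not_le.2 hy (csInf_le hbdd h)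
  obtain ⟨K, hK⟩ := exists_sum_increments_le hHs hH hw hwper
  -- The lower bound that the cross-ratio estimate will give for j₀ - a; ε is then chosen so that 2δ
  -- < t - H (j₀ - η), which contradicts it.
  set η := (j₁ - j₀) / (3 * Real.exp (6 * K)) with hη
  have hη0 : 0 < η := div_pos (sub_pos.2 hj) (by positivity)
  have hx₀ := hleft (j₀ - η) (by linarith)
  obtain ⟨q, δ, hq, hδ, hδε, hsep, hright, hleftn⟩ := hα.exists_separated_orbit
    (ε := min 1 ((t - H (j₀ - η)) / 2)) (lt_min one_pos (by linarith))
  have hδ1 := hδε.trans_le (min_le_left _ _)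
  have hδ2 := hδε.trans_le (min_le_right _ _)
  -- F^m J is the shortest iterate; a and d are the preimages under F^m of the outer ends of its
  -- left and right neighbours.
  obtain ⟨m, hmq, hmin⟩ := Finset.exists_min_image (Finset.range q)
    (fun i => F^[i] j₁ - F^[i] j₀) ⟨0, Finset.mem_range.2 hq⟩
  rw [Finset.mem_range] at hmq
  obtain ⟨k, hk, n, hn1, hn2⟩ := hleftn m hmq
  obtain ⟨k', hk', n', hn1', hn2'⟩ := hright m hmq
  obtain ⟨a, ha⟩ := hFs.iterate m (F^[k] j₀ - n)
  obtain ⟨d, hd⟩ := hFs.iterate m (F^[k'] j₁ + n')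
  have hHa : H a = t - ((m - k) * α + n) := by
    have := semiconj_iterate hH m a
    rw [ha, H.map_sub_int, semiconj_iterate hH, hj₀t] at this
    linarith
  have hHd : H d = t + ((k' - m) * α + n') := by
    have := semiconj_iterate hH m d
    rw [hd, H.map_add_int, semiconj_iterate hH, ← heq] at this
    linarith
  have haj : a < j₀ := hlt (by rw [hHa, hj₀t]; linarith)
  have hdj : j₁ < d := hlt (by rw [hHd, ← heq]; linarith)
  have hcr := crossRatio_le_iterate hF hpos hw hφ haj hj hdj m
  have hsum := hK q δ hδ hδ1 hsep a j₀ d (by rw [hHa, hj₀t]; linarith)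
    (by rw [hHd, hj₀t]; linarith) m hmq.le
  -- The neighbours lie over other points of the rotation, hence are disjoint from F^m J and fit
  -- entirely into the gaps beside it.
  have hL : F^[k] j₁ - n < F^[m] j₀ := hlt (by
    rw [H.map_sub_int, semiconj_iterate hH, semiconj_iterate hH, ← heq, hj₀t]; linarith)
  have hR : F^[m] j₁ < F^[k'] j₀ + n' := hlt (by
    rw [H.map_add_int, semiconj_iterate hH, semiconj_iterate hH, ← heq, hj₀t]; linarith)
  have hmk := hmin k (Finset.mem_range.2 hk)
  have hmk' := hmin k' (Finset.mem_range.2 hk')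
  have h3 : crossRatio (F^[m] a) (F^[m] j₀) (F^[m] j₁) (F^[m] d) ≤ 3 := by
    refine crossRatio_le_three (hmono.iterate m hj) ?_ ?_
    · rw [ha]; linarith
    · rw [hd]; linarith
  have hfin : (j₁ - j₀) / (j₀ - a) ≤ Real.exp (6 * K) * 3 := by
    refine (div_le_crossRatio haj hj hdj).trans (hcr.trans ?_)
    refine (mul_le_mul_of_nonneg_left h3 (Real.exp_pos _).le).trans ?_
    gcongr
  have hηa : η ≤ j₀ - a := by
    rw [div_le_iff₀ (by linarith)] at hfin
    rw [hη, div_le_iff₀ (by positivity)]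
    linarith
  have := H.monotone (show a ≤ j₀ - η by linarith)
  rw [hHa] at this
  linarith

end NoWanderingIntervals

/-! ### From the semiconjugacy to the criterion. -/

section Criterion

variable {f : UnitAddCircle ≃ₜ UnitAddCircle} {F : CircleDeg1Lift}

theorem IsCircleC1Diffeo.bijective (hf : IsCircleC1Diffeo F f) : Function.Bijective F :=
  ⟨(strictMono_of_deriv_pos hf.deriv_pos).injective,
    F.continuous_iff_surjective.1 hf.lift.continuous⟩

theorem IsCircleC1Diffeo.continuous_logOfDeriv (hf : IsCircleC1Diffeo F f) :
    Continuous (logOfDeriv F) :=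
  _root_.continuous_logOfDeriv hf.contDiff hf.deriv_pos

theorem exists_abs_le_of_periodic {φ : ℝ → ℝ} (hφ : Continuous φ)
    (hper : ∀ x (n : ℤ), φ (x + n) = φ x) : ∃ M, ∀ x, |φ x| ≤ M := by
  obtain ⟨M, hM⟩ := isCompact_Icc.exists_bound_of_continuousOn (s := Set.Icc (0 : ℝ) 1)
    hφ.continuousOn
  refine ⟨M, fun x => ?_⟩
  rw [← Int.fract_add_floor x, hper]
  exact hM _ ⟨Int.fract_nonneg x, (Int.fract_lt_one x).le⟩

/-- An orientation-preserving homeomorphism with irrational rotation number is semiconjugate to a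
rotation, by a continuous map. -/
theorem exists_continuous_semiconj (hF : Function.Bijective F)
    (hα : Irrational F.translationNumber) :
    ∃ H : CircleDeg1Lift, Continuous H ∧ ∀ x, H (F x) = H x + F.translationNumber := by
  set α := F.translationNumber with hα'
  have hbij : Function.Bijective
      (CircleDeg1Lift.translate (Multiplicative.ofAdd α) : CircleDeg1Lift) :=
    CircleDeg1Lift.isUnit_iff_bijective.1 (Units.isUnit _)
  obtain ⟨H, hH⟩ := CircleDeg1Lift.semiconj_of_bijective_of_translationNumber_eq hF hbij
    (CircleDeg1Lift.translationNumber_translate α).symm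
  have hsemi : ∀ x, H (F x) = H x + α := fun x => by
    rw [hH x, CircleDeg1Lift.translate_apply, add_comm]
  -- A monotone map with dense range is continuous. The range is stable under translation by kα - n,
  -- which can be made arbitrarily small and is nonzero.
  refine ⟨H, H.monotone.continuous_of_denseRange ?_, hsemi⟩
  refine Metric.dense_iff.2 fun x r hr => ?_
  obtain ⟨k, hk, n, hn⟩ := Irrational.exists_abs_mul_sub_lt α hr
  have hpos := hα.abs_mul_sub_pos hk n
  set s := (k : ℝ) * α - n with hs
  have hreal : ∀ j : ℕ, ∀ y l, H y = l → ∃ y', H y' = l + j * s ∧ ∃ y'', H y'' = l - j * s := by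
    intro j y l hy
    obtain ⟨y'', hy''⟩ := hF.2.iterate (j * k) y
    refine ⟨F^[j * k] y - (j * n : ℤ), ?_, y'' + (j * n : ℤ), ?_⟩
    · rw [H.map_sub_int, semiconj_iterate hsemi, hy, hs]; push_cast; ring
    · have := semiconj_iterate hsemi (j * k) y''
      rw [hy'', hy] at this
      rw [H.map_add_int, hs]
      push_cast at this ⊢
      linarith
  set N := ⌊(x - H 0) / |s|⌋ with hN
  have h1 : N * |s| ≤ x - H 0 := by
    rw [← le_div_iff₀ hpos]; exact Int.floor_le _
  have h2 : x - H 0 < (N + 1) * |s| := by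
    rw [← div_lt_iff₀ hpos]; exact Int.lt_floor_add_one _
  have hex : ∃ y, H y = H 0 + N * |s| := by
    obtain ⟨y', hy', y'', hy''⟩ := hreal N.natAbs 0 _ rfl
    have hNa : ((N.natAbs : ℕ) : ℝ) = |(N : ℝ)| := by
      rw [← Int.cast_abs, Int.abs_eq_natAbs]; simp
    rw [hNa] at hy' hy''
    rcases abs_cases s with ⟨h, -⟩ | ⟨h, -⟩ <;> rcases abs_cases (N : ℝ) with ⟨h', -⟩ | ⟨h', -⟩ <;>
      rw [h] <;> rw [h'] at hy' hy''
    · exact ⟨y', hy'⟩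
    · exact ⟨y'', by rw [hy'']; ring⟩
    · exact ⟨y'', by rw [hy'']; ring⟩
    · exact ⟨y', by rw [hy']; ring⟩
  obtain ⟨y, hy⟩ := hex
  refine ⟨H y, ?_, y, rfl⟩
  rw [Metric.mem_ball, Real.dist_eq, hy, abs_lt]
  constructor <;> linarith

theorem IsCircleLift.iterate (hf : IsCircleLift F f) (n : ℕ) (x : ℝ) :
    ((F^[n] x : ℝ) : UnitAddCircle) = f^[n] (x : UnitAddCircle) := by
  induction n with
  | zero => rfl
  | succ n ih => rw [Function.iterate_succ_apply', Function.iterate_succ_apply', hf.semiconj, ih]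

/-- For u < v in the arc, some kα is closer to an integer than H v - H u. Modulo 1, F^k then moves u
or v, according to the sign, back into the arc. -/
theorem not_isWanderingInterval (hf : IsCircleLift F f) {H : CircleDeg1Lift} {α : ℝ}
    (hα : Irrational α) (hHs : StrictMono H) (hH : ∀ x, H (F x) = H x + α)
    (J : Set UnitAddCircle) : ¬ IsWanderingInterval f J := by
  rintro ⟨⟨I, hI, hnt, rfl⟩, hdisj⟩
  obtain ⟨u, hu, v, hv, huv⟩ := hnt.exists_lt
  obtain ⟨k, hk, n, hn⟩ := Irrational.exists_abs_mul_sub_lt α (sub_pos.2 (hHs huv))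
  have hpos := hα.abs_mul_sub_pos hk n
  have key : ∀ x ∈ I, F^[k] x - n ∈ I → False := by
    intro x hx hx'
    have hd := Set.disjoint_left.1 (hdisj 0 k hk.ne)
    refine hd (a := ((F^[k] x - n : ℝ) : UnitAddCircle)) ?_ ?_
    · exact ⟨_, ⟨_, hx', rfl⟩, rfl⟩
    · refine ⟨_, ⟨x, hx, rfl⟩, ?_⟩
      rw [← hf.iterate]
      exact UnitAddCircle.coe_eq_coe_iff.2 ⟨n, by ring⟩
  have hval : ∀ x, H (F^[k] x - n) = H x + (k * α - n) := fun x => by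
    rw [H.map_sub_int, semiconj_iterate hH]; ring
  have hmem : ∀ x, H u < H x → H x < H v → x ∈ I := fun x h1 h2 =>
    hI.out hu hv ⟨(hHs.lt_iff_lt.1 h1).le, (hHs.lt_iff_lt.1 h2).le⟩
  rcases abs_cases ((k : ℝ) * α - n) with ⟨h, -⟩ | ⟨h, -⟩ <;> rw [h] at hn hpos
  · exact key u hu (hmem _ (by rw [hval]; linarith) (by rw [hval]; linarith))
  · exact key v hv (hmem _ (by rw [hval]; linarith) (by rw [hval]; linarith))

theorem isConjugateToRotation_of_semiconj (hf : IsCircleLift F f) {H : CircleDeg1Lift} {α : ℝ}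
    (hHc : Continuous H) (hHs : StrictMono H) (hH : ∀ x, H (F x) = H x + α) :
    IsConjugateToRotation f α := by
  obtain ⟨h, hh⟩ := H.exists_homeomorph hHc hHs
  refine ⟨h, fun x => ?_⟩
  induction x using QuotientAddGroup.induction_on with | H x => ?_
  change h (f (x : UnitAddCircle)) = h (x : UnitAddCircle) + _
  rw [← hf.semiconj, ← hh, ← hh, hH, AddCircle.coe_add]

theorem exists_monotone_dominating_logOfDeriv (hf : IsCircleC1Diffeo F f)
    (hz : HasBoundedZygmundVariation (logOfDeriv F) 0 1)
    (hq : HasBoundedQuadraticVariation (logOfDeriv F) 0 1) :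
    ∃ w : ℝ → ℝ, Monotone w ∧ (∀ x y (n : ℤ), w (x + n) - w (y + n) = w x - w y) ∧
      ∀ u v, u < v → |logOfDeriv F u + logOfDeriv F v - 2 * logOfDeriv F ((u + v) / 2)| +
        (logOfDeriv F v - logOfDeriv F u) ^ 2 ≤ w v - w u := by
  obtain ⟨-, B₁, -, hB₁⟩ := hz
  obtain ⟨-, B₂, -, hB₂⟩ := hq
  obtain ⟨M, hM⟩ := exists_abs_le_of_periodic hf.continuous_logOfDeriv (logOfDeriv_add_int F)
  refine exists_monotone_dominating_function (B := B₁ + B₂) (C := 4 * M + (2 * M) ^ 2)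
    (ρ := fun u v => |logOfDeriv F u + logOfDeriv F v - 2 * logOfDeriv F ((u + v) / 2)| +
        (logOfDeriv F v - logOfDeriv F u) ^ 2) ?_ ?_ ?_ ?_
  · intro n x hx
    rw [Finset.sum_add_distrib]
    exact add_le_add (hB₁ n x hx) (hB₂ n x hx)
  · intro u v; positivity
  · intro u v
    have h1 := abs_le.1 (hM u)
    have h2 := abs_le.1 (hM v)
    have h3 := abs_le.1 (hM ((u + v) / 2))
    refine add_le_add (abs_le.2 ⟨by linarith, by linarith⟩) ?_
    exact sq_le_sq' (by linarith) (by linarith)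
  · intro u v n
    have e : (u + n + (v + n)) / 2 = (u + v) / 2 + n := by ring
    simp only [e, logOfDeriv_add_int]

/-- Denjoy's theorem under bounded Zygmund variation and bounded quadratic variation. -/
theorem IsCircleC1Diffeo.isConjugateToRotation (hf : IsCircleC1Diffeo F f)
    (hα : Irrational F.translationNumber) (hz : HasBoundedZygmundVariation (logOfDeriv F) 0 1)
    (hq : HasBoundedQuadraticVariation (logOfDeriv F) 0 1) :
    (¬ ∃ J : Set UnitAddCircle, IsWanderingInterval f J) ∧
      IsConjugateToRotation f F.translationNumber := by
  obtain ⟨w, hw, hwper, hφ⟩ := exists_monotone_dominating_logOfDeriv hf hz hq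
  obtain ⟨H, hHc, hH⟩ := exists_continuous_semiconj hf.bijective hα
  have hHs : StrictMono H := H.strictMono_iff_injective.2
    (injective_of_semiconj hf.contDiff hf.deriv_pos hα hHc hH hw hwper hφ)
  exact ⟨fun ⟨J, hJ⟩ => not_isWanderingInterval hf.lift hα hHs hH J hJ,
    isConjugateToRotation_of_semiconj hf.lift hHc hHs hH⟩

end Criterion

/-! ### Bounded variation and the Zygmund condition imply the criterion's hypotheses. -/

section SufficientConditions

variable {φ : ℝ → ℝ}

theorem hasBoundedZygmundVariation_of_dominated (hφ : ContinuousOn φ (Set.Icc 0 1)) {w : ℝ → ℝ}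
    (hw : ∀ u ∈ Set.Icc (0 : ℝ) 1, ∀ v ∈ Set.Icc (0 : ℝ) 1, u < v →
      |φ u + φ v - 2 * φ ((u + v) / 2)| ≤ w v - w u) :
    HasBoundedZygmundVariation φ 0 1 :=
  ⟨hφ, max 1 (w 1 - w 0), by positivity, fun _ _ hx =>
    (hx.sum_le (ρ := fun u v => |φ u + φ v - 2 * φ ((u + v) / 2)|) hw).trans (le_max_right _ _)⟩

theorem hasBoundedQuadraticVariation_of_dominated (hφ : ContinuousOn φ (Set.Icc 0 1)) {w : ℝ → ℝ}
    (hw : ∀ u ∈ Set.Icc (0 : ℝ) 1, ∀ v ∈ Set.Icc (0 : ℝ) 1, u < v →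
      (φ v - φ u) ^ 2 ≤ w v - w u) :
    HasBoundedQuadraticVariation φ 0 1 :=
  ⟨hφ, max 1 (w 1 - w 0), by positivity, fun _ _ hx =>
    (hx.sum_le (ρ := fun u v => (φ v - φ u) ^ 2) hw).trans (le_max_right _ _)⟩

/-- A second difference is a difference of two adjacent increments, and a squared increment is at
most the total variation times the variation over the interval. -/
theorem BoundedVariationOn.zygmund_and_quadratic (hφ : ContinuousOn φ (Set.Icc 0 1))
    (h : BoundedVariationOn φ (Set.Icc 0 1)) :
    HasBoundedZygmundVariation φ 0 1 ∧ HasBoundedQuadraticVariation φ 0 1 := by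
  have hloc := h.locallyBoundedVariationOn
  have h0 : (0 : ℝ) ∈ Set.Icc (0 : ℝ) 1 := ⟨le_rfl, zero_le_one⟩
  have h1 : (1 : ℝ) ∈ Set.Icc (0 : ℝ) 1 := ⟨zero_le_one, le_rfl⟩
  set w := variationOnFromTo φ (Set.Icc 0 1) 0 with hw
  have hmono : MonotoneOn w (Set.Icc 0 1) := variationOnFromTo.monotoneOn hloc h0
  have habs : ∀ u ∈ Set.Icc (0 : ℝ) 1, ∀ v ∈ Set.Icc (0 : ℝ) 1, u ≤ v →
      |φ v - φ u| ≤ w v - w u := by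
    intro u hu v hv huv
    rw [hw, ← variationOnFromTo.add hloc h0 hu hv, add_sub_cancel_left,
      variationOnFromTo.eq_of_le _ _ huv, ← Real.dist_eq, dist_edist]
    refine ENNReal.toReal_mono (hloc u v hu hv) ?_
    exact eVariationOn.edist_le φ ⟨hv, huv, le_rfl⟩ ⟨hu, le_rfl, huv⟩
  refine ⟨hasBoundedZygmundVariation_of_dominated hφ (w := w) fun u hu v hv huv => ?_,
    hasBoundedQuadraticVariation_of_dominated hφ (w := fun x => (w 1 - w 0) * w x)
      fun u hu v hv huv => ?_⟩
  · have hm : (u + v) / 2 ∈ Set.Icc (0 : ℝ) 1 :=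
      ⟨by linarith [hu.1, hv.1], by linarith [hu.2, hv.2]⟩
    have a1 := abs_le.1 (habs u hu _ hm (by linarith))
    have a2 := abs_le.1 (habs _ hm v hv (by linarith))
    exact abs_le.2 ⟨by linarith, by linarith⟩
  · have a := habs u hu v hv huv.le
    have b1 := hmono h0 hu hu.1
    have b2 := hmono hv h1 hv.2
    rw [← sq_abs, sq, ← mul_sub]
    exact mul_le_mul (by linarith) a (abs_nonneg _) (by linarith [hmono h0 h1 zero_le_one])

/-- A bounded function satisfying the Zygmund condition is Hölder continuous of exponent `1/2`. -/
theorem ZygmundCondition.exists_abs_sub_le_sqrt (h : ZygmundCondition φ) {M : ℝ}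
    (hM : ∀ x, |φ x| ≤ M) :
    ∃ C, ∀ x t, 0 < t → t ≤ 1 → |φ (x + t) - φ x| ≤ C * √t := by
  obtain ⟨-, B, hB, hz⟩ := h
  have hM0 : 0 ≤ M := (abs_nonneg _).trans (hM 0)
  have hz' : ∀ x t, 0 < t → |φ (x + t) + φ (x - t) - 2 * φ x| ≤ B * t := by
    intro x t ht
    have := hz x t ht.ne'
    rwa [abs_div, abs_of_pos ht, div_le_iff₀ ht] at this
  -- For t ≥ 1/2 the term 4M suffices. Below that, the Zygmund condition at x + t bounds the
  -- increment over t by half that over 2t plus Bt/2; since √2 ≤ 3/2, the induction closes when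
  -- C·3/4 + B/2 ≤ C, that is C ≥ 2B.
  refine ⟨2 * B + 4 * M, fun x t ht ht1 => ?_⟩
  have key : ∀ n : ℕ, ∀ t : ℝ, (1 / 2 : ℝ) ^ n ≤ t → t ≤ 1 → ∀ x,
      |φ (x + t) - φ x| ≤ (2 * B + 4 * M) * √t := by
    have big : ∀ t : ℝ, 1 / 2 ≤ t → ∀ x, |φ (x + t) - φ x| ≤ (2 * B + 4 * M) * √t := by
      intro t ht x
      have h1 : 1 / 2 ≤ √t := by
        rw [Real.le_sqrt (by norm_num) (by linarith)]; linarith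
      have a1 := abs_le.1 (hM (x + t))
      have a2 := abs_le.1 (hM x)
      have : |φ (x + t) - φ x| ≤ 2 * M := abs_le.2 ⟨by linarith, by linarith⟩
      nlinarith
    intro n
    induction n with
    | zero => intro t ht _ x; exact big t (by linarith [pow_zero (1 / 2 : ℝ)]) x
    | succ n ih =>
      intro t ht ht1 x
      rcases le_or_gt (1 / 2) t with h | h
      · exact big t h x
      · have ht0 : 0 < t := lt_of_lt_of_le (by positivity) ht
        have h2 := ih (2 * t) (by rw [pow_succ] at ht; linarith) (by linarith) x
        have h3 := hz' (x + t) t ht0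
        rw [show x + t + t = x + 2 * t by ring, show x + t - t = x by ring] at h3
        have hs : √(2 * t) ≤ (3 / 2) * √t := by
          rw [Real.sqrt_mul (by norm_num)]
          gcongr
          rw [Real.sqrt_le_left (by norm_num)]; norm_num
        have ht2 : t ≤ √t := by
          rw [Real.le_sqrt ht0.le ht0.le]; nlinarith
        rw [abs_le] at h2 h3
        have h4 : (2 * B + 4 * M) * √(2 * t) ≤ (2 * B + 4 * M) * ((3 / 2) * √t) := by gcongr
        have h5 : B * t ≤ B * √t := by gcongr
        have h6 : 0 ≤ M * √t := by positivity
        exact abs_le.2 ⟨by nlinarith, by nlinarith⟩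
  obtain ⟨n, hn⟩ := exists_pow_lt_of_lt_one ht (show (1 / 2 : ℝ) < 1 by norm_num)
  exact key n t hn.le ht1 x

/-- Second differences, and by the Hölder 1/2 bound squared increments, are at most a constant times
the length, so linear functions dominate. -/
theorem ZygmundCondition.zygmund_and_quadratic (h : ZygmundCondition φ) {M : ℝ}
    (hM : ∀ x, |φ x| ≤ M) :
    HasBoundedZygmundVariation φ 0 1 ∧ HasBoundedQuadraticVariation φ 0 1 := by
  obtain ⟨C, hC⟩ := h.exists_abs_sub_le_sqrt hM
  obtain ⟨hc, B, hB, hz⟩ := h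
  refine ⟨hasBoundedZygmundVariation_of_dominated hc.continuousOn (w := fun x => B * x)
    fun u hu v hv huv => ?_, hasBoundedQuadraticVariation_of_dominated hc.continuousOn
      (w := fun x => C ^ 2 * x) fun u hu v hv huv => ?_⟩
  · have ht : 0 < (v - u) / 2 := by linarith
    have := hz ((u + v) / 2) ((v - u) / 2) ht.ne'
    rw [abs_div, abs_of_pos ht, div_le_iff₀ ht, show (u + v) / 2 + (v - u) / 2 = v by ring,
      show (u + v) / 2 - (v - u) / 2 = u by ring, add_comm (φ v)] at this
    nlinarith
  · have := hC u (v - u) (by linarith) (by linarith [hu.1, hv.2])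
    rw [add_sub_cancel] at this
    rw [← sq_abs, ← mul_sub]
    calc |φ v - φ u| ^ 2 ≤ (C * √(v - u)) ^ 2 := by gcongr
      _ = C ^ 2 * (v - u) := by rw [mul_pow, Real.sq_sqrt (by linarith)]

end SufficientConditions

/-! ### Diffeomorphisms showing that the criterion is strictly weaker. -/

section Examples

open Filter Topology

/-- Some translate of a degree one map has irrational translation number. -/
theorem CircleDeg1Lift.exists_irrational_translationNumber (F : CircleDeg1Lift)
    (hF : Continuous F) :
    ∃ (t : ℝ) (G : CircleDeg1Lift), (∀ x, G x = F x + t) ∧ Irrational G.translationNumber := by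
  let G : ℝ → CircleDeg1Lift := fun t =>
    (CircleDeg1Lift.translate (Multiplicative.ofAdd t) : CircleDeg1Lift) * F
  have hG : ∀ t x, G t x = F x + t := fun t x => by
    rw [CircleDeg1Lift.mul_apply, CircleDeg1Lift.translate_apply, add_comm]
  have hcont : ∀ n : ℕ, Continuous fun t => (G t ^ n) 0 := by
    intro n
    simp only [CircleDeg1Lift.coe_pow]
    induction n with
    | zero => exact continuous_const
    | succ n ih =>
      simp only [Function.iterate_succ_apply', hG]
      exact (hF.comp ih).add continuous_id
  have hr : ∀ r : ℚ, (r.den : ℝ) * r = r.num := fun r => by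
    exact_mod_cast Rat.den_mul_eq_num r
  have hden : ∀ r : ℚ, (0 : ℝ) < r.den := fun r => by exact_mod_cast r.den_pos
  by_contra! hrat
  have hne : ∀ t, (G t).translationNumber ≠ √2 := fun t h =>
    hrat t (G t) (hG t) (h ▸ irrational_sqrt_two)
  -- A rational strictly between the translation number and √2 turns the inequality into one on a
  -- single iterate at 0, which persists for nearby t. Connectedness of the line then forbids
  -- skipping √2.
  have hU : IsOpen {t | (G t).translationNumber < √2} := by
    refine isOpen_iff_mem_nhds.2 fun t ht => ?_
    obtain ⟨r, hr1, hr2⟩ := exists_rat_btwn (show (G t).translationNumber < √2 from ht)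
    have h1 : (G t ^ r.den) 0 < 0 + r.num := by
      refine CircleDeg1Lift.map_lt_of_translationNumber_lt_int _ ?_ 0
      rw [CircleDeg1Lift.translationNumber_pow, ← hr]
      exact mul_lt_mul_of_pos_left hr1 (hden r)
    filter_upwards [(hcont r.den).continuousAt.eventually (gt_mem_nhds h1)] with s hs
    have := CircleDeg1Lift.translationNumber_le_of_le_add_int _ hs.le
    rw [CircleDeg1Lift.translationNumber_pow, ← hr] at this
    exact (le_of_mul_le_mul_left this (hden r)).trans_lt hr2
  have hV : IsOpen {t | √2 < (G t).translationNumber} := by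
    refine isOpen_iff_mem_nhds.2 fun t ht => ?_
    obtain ⟨r, hr1, hr2⟩ := exists_rat_btwn (show √2 < (G t).translationNumber from ht)
    have h1 : 0 + r.num < (G t ^ r.den) 0 := by
      refine CircleDeg1Lift.lt_map_of_int_lt_translationNumber _ ?_ 0
      rw [CircleDeg1Lift.translationNumber_pow, ← hr]
      exact mul_lt_mul_of_pos_left hr2 (hden r)
    filter_upwards [(hcont r.den).continuousAt.eventually (lt_mem_nhds h1)] with s hs
    have := CircleDeg1Lift.le_translationNumber_of_add_int_le _ hs.le
    rw [CircleDeg1Lift.translationNumber_pow, ← hr] at this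
    exact hr1.trans_le (le_of_mul_le_mul_left this (hden r))
  have h0 : (G (-F 0)).translationNumber = 0 := by
    have := (G (-F 0)).translationNumber_of_eq_add_int (x := 0) (m := 0) (by simp [hG])
    simpa using this
  have h2 : (G (2 - F 0)).translationNumber = 2 := by
    have := (G (2 - F 0)).translationNumber_of_eq_add_int (x := 0) (m := 2) (by simp [hG])
    simpa using this
  obtain ⟨t, -, ht1, ht2⟩ := isPreconnected_univ _ _ hU hV
    (fun t _ => lt_or_gt_of_ne (hne t))
    ⟨-F 0, trivial, by rw [Set.mem_ofPred_eq, h0]; positivity⟩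
    ⟨2 - F 0, trivial, by
      rw [Set.mem_ofPred_eq, h2, Real.sqrt_lt' two_pos]; norm_num⟩
  exact lt_asymm (show (G t).translationNumber < √2 from ht1)
    (show √2 < (G t).translationNumber from ht2)

/-- Every continuous periodic function is, up to an additive constant, the logarithm of the
derivative of a diffeomorphism with irrational rotation number. -/
theorem exists_isCircleC1Diffeo_logOfDeriv_eq {φ : ℝ → ℝ} (hφ : Continuous φ)
    (hper : Function.Periodic φ 1) :
    ∃ (f : UnitAddCircle ≃ₜ UnitAddCircle) (F : CircleDeg1Lift) (c : ℝ),
      IsCircleC1Diffeo F f ∧ Irrational F.translationNumber ∧ logOfDeriv F = fun x => φ x - c := by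
  have he : Continuous fun x => Real.exp (φ x) := by fun_prop
  set I := ∫ x in (0 : ℝ)..1, Real.exp (φ x) with hI
  have hIpos : 0 < I := intervalIntegral.intervalIntegral_pos_of_pos
    (he.intervalIntegrable _ _) (fun x => Real.exp_pos _) one_pos
  have hderiv : ∀ x, HasDerivAt (fun x => (∫ y in (0 : ℝ)..x, Real.exp (φ y)) / I)
      (Real.exp (φ x) / I) x := fun x => (he.integral_hasStrictDerivAt 0 x).hasDerivAt.div_const I
  have hmono : StrictMono fun x => (∫ y in (0 : ℝ)..x, Real.exp (φ y)) / I :=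
    strictMono_of_deriv_pos fun x => by rw [(hderiv x).deriv]; positivity
  -- The primitive of exp φ, normalised to degree one; translating it adjusts the rotation number
  -- without changing the derivative.
  let F₀ : CircleDeg1Lift :=
    ⟨⟨fun x => (∫ y in (0 : ℝ)..x, Real.exp (φ y)) / I, hmono.monotone⟩, fun x => by
      have hp : Function.Periodic (fun x => Real.exp (φ x)) 1 := fun x => by simp only [hper x]
      have h1 : ∫ y in x..x + 1, Real.exp (φ y) = I := by
        rw [hp.intervalIntegral_add_eq x 0, zero_add]
      show (∫ y in (0 : ℝ)..x + 1, Real.exp (φ y)) / I = (∫ y in (0 : ℝ)..x, Real.exp (φ y)) / I + 1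
      rw [← intervalIntegral.integral_add_adjacent_intervals (he.intervalIntegrable 0 x)
        (he.intervalIntegrable x (x + 1)), h1, add_div, div_self hIpos.ne']⟩
  have hF₀ : ∀ x, HasDerivAt F₀ (Real.exp (φ x) / I) x := hderiv
  have hF₀c : Continuous F₀ := continuous_iff_continuousAt.2 fun x => (hF₀ x).continuousAt
  obtain ⟨t, F, hF, hirr⟩ := F₀.exists_irrational_translationNumber hF₀c
  have hFeq : ⇑F = fun x => F₀ x + t := funext hF
  have hFd : ∀ x, HasDerivAt F (Real.exp (φ x) / I) x := fun x => by
    rw [hFeq]; exact (hF₀ x).add_const t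
  have hFderiv : deriv F = fun x => Real.exp (φ x) / I := funext fun x => (hFd x).deriv
  have hpos : ∀ x, 0 < deriv F x := fun x => by rw [hFderiv]; positivity
  have hcd : ContDiff ℝ 1 F := contDiff_one_iff_deriv.2
    ⟨fun x => (hFd x).differentiableAt, by rw [hFderiv]; exact he.div_const I⟩
  obtain ⟨f, hf⟩ := F.exists_homeomorph hcd.continuous (strictMono_of_deriv_pos hpos)
  refine ⟨f, F, Real.log I, ⟨⟨hcd.continuous, hf⟩, hcd, hpos⟩, hirr, funext fun x => ?_⟩
  rw [logOfDeriv, hFderiv, Real.log_div (Real.exp_pos _).ne' hIpos.ne', Real.log_exp]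

theorem BoundedVariationOn.sub_const {φ : ℝ → ℝ} {s : Set ℝ} (h : BoundedVariationOn φ s) (c : ℝ) :
    BoundedVariationOn (fun x => φ x - c) s :=
  LipschitzWith.comp_boundedVariationOn (C := 1) (f := fun y : ℝ => y - c)
    (LipschitzWith.of_dist_le_mul fun x y => by simp) h

theorem zygmundCondition_sub_const {φ : ℝ → ℝ} {c : ℝ} :
    ZygmundCondition (fun x => φ x - c) ↔ ZygmundCondition φ := by
  refine and_congr ?_ ?_
  · constructor <;> intro h
    · simpa using h.add_const c
    · exact h.sub continuous_const
  · have e : ∀ x t, φ (x + t) - c + (φ (x - t) - c) - 2 * (φ x - c) =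
        φ (x + t) + φ (x - t) - 2 * φ x := fun x t => by ring
    simp only [e]

/-- A function of bounded variation with a cusp. -/
noncomputable def cusp (x : ℝ) : ℝ := √|Real.sin (Real.pi * x)|

theorem continuous_cusp : Continuous cusp := by unfold cusp; fun_prop

theorem periodic_cusp : Function.Periodic cusp 1 := fun x => by
  rw [cusp, cusp, mul_add, mul_one, Real.sin_add_pi, abs_neg]

theorem boundedVariationOn_cusp : BoundedVariationOn cusp (Set.Icc 0 1) := by
  have hmono : MonotoneOn cusp (Set.Icc 0 (1 / 2)) := by
    intro x hx y hy hxy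
    have hπ := Real.pi_pos
    have h0 : 0 ≤ Real.sin (Real.pi * x) :=
      Real.sin_nonneg_of_nonneg_of_le_pi (mul_nonneg hπ.le hx.1) (by nlinarith [hx.2])
    refine Real.sqrt_le_sqrt ?_
    rw [abs_of_nonneg h0]
    refine le_trans ?_ (le_abs_self _)
    refine Real.sin_le_sin_of_le_of_le_pi_div_two ?_ ?_ ?_
    · linarith [mul_nonneg hπ.le hx.1]
    · nlinarith [hy.2]
    · gcongr
  have h1 : eVariationOn cusp (Set.Icc 0 (1 / 2)) ≠ ⊤ := by
    have := hmono.eVariationOn_eq (a := 0) (b := 1 / 2) ⟨le_rfl, by norm_num⟩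
      ⟨by norm_num, le_rfl⟩
    rw [Set.inter_self] at this
    rw [this]
    exact ENNReal.ofReal_ne_top
  have hsymm : cusp ∘ (fun x => 1 - x) = cusp := funext fun x => by
    simp only [Function.comp, cusp, mul_sub, mul_one, Real.sin_pi_sub]
  have h2 : eVariationOn cusp (Set.Icc (1 / 2) 1) ≤ eVariationOn cusp (Set.Icc 0 (1 / 2)) := by
    conv_lhs => rw [← hsymm]
    refine eVariationOn.comp_le_of_antitoneOn cusp (fun x => 1 - x)
      (fun x _ y _ hxy => sub_le_sub_left hxy 1) fun x hx => ⟨?_, ?_⟩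
    · linarith [hx.2]
    · linarith [hx.1]
  have h3 := eVariationOn.Icc_add_Icc cusp (s := Set.univ) (a := 0) (b := 1 / 2) (c := 1)
    (by norm_num) (by norm_num) trivial
  simp only [Set.univ_inter] at h3
  rw [BoundedVariationOn, ← h3]
  exact ENNReal.add_ne_top.2 ⟨h1, ne_top_of_le_ne_top h1 h2⟩

/-- At 0 the second difference is at least 2√(2t), which is not O(t). -/
theorem not_zygmundCondition_cusp : ¬ ZygmundCondition cusp := by
  rintro ⟨-, B, hB, h⟩
  set t : ℝ := 1 / (B ^ 2 + 2) with ht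
  have ht0 : 0 < t := by positivity
  have ht1 : t ≤ 1 / 2 := by
    rw [ht]; gcongr; nlinarith [sq_nonneg B]
  have hπ := Real.pi_pos
  have hsin : 2 * t ≤ Real.sin (Real.pi * t) := by
    have := Real.mul_le_sin (x := Real.pi * t) (by positivity) (by nlinarith)
    calc 2 * t = 2 / Real.pi * (Real.pi * t) := by field_simp
      _ ≤ _ := this
  have hc : √(2 * t) ≤ cusp t := Real.sqrt_le_sqrt (hsin.trans (le_abs_self _))
  have hneg : cusp (-t) = cusp t := by simp [cusp]
  have h0 : cusp 0 = 0 := by simp [cusp]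
  have := h 0 t ht0.ne'
  rw [zero_add, zero_sub, hneg, h0, mul_zero, sub_zero, abs_div, abs_of_pos ht0,
    div_le_iff₀ ht0] at this
  have h1 : 2 * √(2 * t) ≤ B * t := by linarith [le_abs_self (cusp t + cusp t)]
  have h2 : (2 * √(2 * t)) ^ 2 ≤ (B * t) ^ 2 := by gcongr
  rw [mul_pow, Real.sq_sqrt (by positivity)] at h2
  have h3 : (B ^ 2 + 2) * t = 1 := by rw [ht]; field_simp
  nlinarith

/-- A lacunary trigonometric series. -/
noncomputable def lacunary (x : ℝ) : ℝ :=
  ∑' n : ℕ, (1 / 2 : ℝ) ^ n * Real.cos (2 * Real.pi * (2 ^ n * x))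

theorem abs_lacunary_term_le (n : ℕ) (x : ℝ) :
    |(1 / 2 : ℝ) ^ n * Real.cos (2 * Real.pi * (2 ^ n * x))| ≤ (1 / 2) ^ n := by
  rw [abs_mul, abs_of_pos (by positivity)]
  exact mul_le_of_le_one_right (by positivity) (Real.abs_cos_le_one _)

theorem summable_lacunary (x : ℝ) :
    Summable fun n : ℕ => (1 / 2 : ℝ) ^ n * Real.cos (2 * Real.pi * (2 ^ n * x)) :=
  .of_norm_bounded summable_geometric_two fun n => abs_lacunary_term_le n x

theorem continuous_lacunary : Continuous lacunary :=
  continuous_tsum (fun n => by fun_prop) summable_geometric_two abs_lacunary_term_le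

theorem abs_lacunary_le (x : ℝ) : |lacunary x| ≤ 2 := by
  exact tsum_of_norm_bounded (f := fun n : ℕ => (1 / 2 : ℝ) ^ n *
    Real.cos (2 * Real.pi * (2 ^ n * x))) hasSum_geometric_two fun n => abs_lacunary_term_le n x

/-- This self-similarity drives the inductions over dyadic scales. -/
theorem lacunary_eq (x : ℝ) :
    lacunary x = Real.cos (2 * Real.pi * x) + 1 / 2 * lacunary (2 * x) := by
  rw [lacunary, (summable_lacunary x).tsum_eq_zero_add, lacunary, ← tsum_mul_left]
  congr 1
  · simp
  · refine tsum_congr fun n => ?_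
    rw [pow_succ, pow_succ, mul_assoc (2 ^ n : ℝ) 2 x]; ring

theorem periodic_lacunary : Function.Periodic lacunary 1 := fun x => by
  refine tsum_congr fun n => ?_
  have e : 2 * Real.pi * (2 ^ n * (x + 1)) = 2 * Real.pi * (2 ^ n * x) + (2 ^ n : ℕ) * (2 * Real.pi) := by
    push_cast; ring
  rw [e, Real.cos_add_nat_mul_two_pi]

/-- The symmetric second difference. -/
def secondDifference (φ : ℝ → ℝ) (x t : ℝ) : ℝ := φ (x + t) + φ (x - t) - 2 * φ x

theorem secondDifference_lacunary (x t : ℝ) :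
    secondDifference lacunary x t = Real.cos (2 * Real.pi * x) * (2 * Real.cos (2 * Real.pi * t) - 2)
      + 1 / 2 * secondDifference lacunary (2 * x) (2 * t) := by
  rw [secondDifference, secondDifference, lacunary_eq (x + t), lacunary_eq (x - t), lacunary_eq x,
    mul_add 2 x t, mul_sub 2 x t, mul_add (2 * Real.pi), mul_sub (2 * Real.pi), Real.cos_add,
    Real.cos_sub]
  ring

theorem abs_secondDifference_lacunary_le {t : ℝ} (ht : 0 < t) (x : ℝ) :
    |secondDifference lacunary x t| ≤ (16 + 4 * Real.pi ^ 2) * t := by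
  have hb : ∀ x t, |secondDifference lacunary x t| ≤ 8 := by
    intro x t
    have h1 := abs_le.1 (abs_lacunary_le (x + t))
    have h2 := abs_le.1 (abs_lacunary_le (x - t))
    have h3 := abs_le.1 (abs_lacunary_le x)
    exact abs_le.2 ⟨by rw [secondDifference]; linarith, by rw [secondDifference]; linarith⟩
  set D := 4 * Real.pi ^ 2 with hD
  have hD0 : 0 ≤ D := by positivity
  -- The correction -Dt² closes the induction: half the bound at 2t is (16 + D)t - 2Dt², and the new
  -- cosine term adds at most Dt².
  have key : ∀ n : ℕ, ∀ t : ℝ, (1 / 2 : ℝ) ^ n ≤ t → t ≤ 1 → ∀ x,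
      |secondDifference lacunary x t| ≤ (16 + D) * t - D * t ^ 2 := by
    have big : ∀ t : ℝ, 1 / 2 ≤ t → t ≤ 1 → ∀ x,
        |secondDifference lacunary x t| ≤ (16 + D) * t - D * t ^ 2 := by
      intro t ht ht1 x
      refine (hb x t).trans ?_
      nlinarith [mul_nonneg hD0 (mul_nonneg (show 0 ≤ t by linarith) (sub_nonneg.2 ht1))]
    intro n
    induction n with
    | zero => intro t ht ht1 x; exact big t (by linarith [pow_zero (1 / 2 : ℝ)]) ht1 x
    | succ n ih =>
      intro t ht ht1 x
      rcases le_or_gt (1 / 2) t with h | h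
      · exact big t h ht1 x
      · have ih' := ih (2 * t) (by rw [pow_succ] at ht; linarith) (by linarith) (2 * x)
        have hcos : |Real.cos (2 * Real.pi * x) * (2 * Real.cos (2 * Real.pi * t) - 2)| ≤
            D * t ^ 2 := by
          rw [abs_mul]
          have h1 := Real.one_sub_sq_div_two_le_cos (x := 2 * Real.pi * t)
          have h2 := Real.cos_le_one (2 * Real.pi * t)
          calc _ ≤ 1 * |2 * Real.cos (2 * Real.pi * t) - 2| := by
                gcongr; exact Real.abs_cos_le_one _
            _ ≤ D * t ^ 2 := by
                rw [one_mul, abs_of_nonpos (by linarith), hD]; linarith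
        rw [secondDifference_lacunary]
        refine (abs_add_le _ _).trans ?_
        rw [abs_mul (1 / 2 : ℝ), abs_of_pos (by norm_num : (0 : ℝ) < 1 / 2)]
        linarith
  rcases le_or_gt t 1 with h | h
  · obtain ⟨n, hn⟩ := exists_pow_lt_of_lt_one ht (show (1 / 2 : ℝ) < 1 by norm_num)
    have := key n t hn.le h x
    nlinarith [mul_nonneg hD0 (sq_nonneg t)]
  · refine (hb x t).trans ?_
    nlinarith

theorem zygmundCondition_lacunary : ZygmundCondition lacunary := by
  refine ⟨continuous_lacunary, 16 + 4 * Real.pi ^ 2, by positivity, fun x t ht => ?_⟩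
  have h : |secondDifference lacunary x t| ≤ (16 + 4 * Real.pi ^ 2) * |t| := by
    rcases abs_cases t with ⟨h1, -⟩ | ⟨h1, h2⟩
    · rw [h1]; exact abs_secondDifference_lacunary_le (h1 ▸ abs_pos.2 ht) x
    · have := abs_secondDifference_lacunary_le (neg_pos.2 h2) x
      rw [h1]
      convert this using 2
      rw [secondDifference, secondDifference]; ring_nf
  rw [abs_div, div_le_iff₀ (abs_pos.2 ht)]
  exact h

theorem integral_cos_two_pi_int {j : ℤ} (hj : j ≠ 0) :
    ∫ x in (0 : ℝ)..1, Real.cos (2 * Real.pi * j * x) = 0 := by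
  have hj' : (j : ℝ) ≠ 0 := by exact_mod_cast hj
  rw [intervalIntegral.integral_comp_mul_left Real.cos
    (mul_ne_zero Real.two_pi_pos.ne' hj'), integral_cos]
  have : Real.sin (2 * Real.pi * j * 1) = 0 := by
    rw [← Real.sin_int_mul_pi (2 * j)]; congr 1; push_cast; ring
  rw [this]; simp

theorem integral_cos_mul_cos (j k : ℤ) (hj : j + k ≠ 0) :
    ∫ x in (0 : ℝ)..1, Real.cos (2 * Real.pi * j * x) * Real.cos (2 * Real.pi * k * x) =
      if j = k then 1 / 2 else 0 := by
  have e : ∀ x : ℝ, Real.cos (2 * Real.pi * j * x) * Real.cos (2 * Real.pi * k * x) =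
      1 / 2 * (Real.cos (2 * Real.pi * (j + k : ℤ) * x) +
        Real.cos (2 * Real.pi * (j - k : ℤ) * x)) := by
    intro x
    have h1 : 2 * Real.pi * ((j + k : ℤ) : ℝ) * x = 2 * Real.pi * j * x + 2 * Real.pi * k * x := by
      push_cast; ring
    have h2 : 2 * Real.pi * ((j - k : ℤ) : ℝ) * x = 2 * Real.pi * j * x - 2 * Real.pi * k * x := by
      push_cast; ring
    rw [h1, h2, Real.cos_add, Real.cos_sub]; ring
  simp only [e]
  rw [intervalIntegral.integral_const_mul, intervalIntegral.integral_add
    (Continuous.intervalIntegrable (by fun_prop) _ _)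
    (Continuous.intervalIntegrable (by fun_prop) _ _), integral_cos_two_pi_int hj, zero_add]
  split_ifs with h
  · subst h; simp
  · rw [integral_cos_two_pi_int (sub_ne_zero.2 h), mul_zero]

theorem Function.Periodic.integral_comp_two_mul {g : ℝ → ℝ} (hg : Function.Periodic g 1)
    (hc : Continuous g) : ∫ x in (0 : ℝ)..1, g (2 * x) = ∫ x in (0 : ℝ)..1, g x := by
  rw [intervalIntegral.integral_comp_mul_left g two_ne_zero, mul_zero, mul_one,
    ← intervalIntegral.integral_add_adjacent_intervals (hc.intervalIntegrable 0 1)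
      (hc.intervalIntegrable 1 2)]
  have h := hg.intervalIntegral_add_eq 1 0
  rw [zero_add, show (1 : ℝ) + 1 = 2 by norm_num] at h
  rw [h, smul_eq_mul]; ring

/-- The normalized second differences of `lacunary` at scale `2⁻¹⁻ᴺ` do not decorrelate from the
`N`-th term of the series. -/
theorem integral_secondDifference_lacunary (N : ℕ) :
    ∫ x in (0 : ℝ)..1, 2 ^ (N + 1) * secondDifference lacunary x ((1 / 2) ^ (N + 1)) *
      Real.cos (2 * Real.pi * (2 ^ N : ℤ) * x) = -4 := by
  have hsd : ∀ t, Continuous fun x => secondDifference lacunary x t := fun t => by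
    have := continuous_lacunary
    unfold secondDifference
    fun_prop
  have hsdper : ∀ t, Function.Periodic (fun x => secondDifference lacunary x t) 1 := fun t x => by
    simp only [secondDifference]
    rw [show x + 1 + t = x + t + 1 by ring, show x + 1 - t = x - t + 1 by ring, periodic_lacunary,
      periodic_lacunary, periodic_lacunary]
  induction N with
  | zero =>
    have e : ∀ x : ℝ, 2 ^ (0 + 1) * secondDifference lacunary x ((1 / 2) ^ (0 + 1)) *
        Real.cos (2 * Real.pi * (2 ^ 0 : ℤ) * x) =
        (-8) * (Real.cos (2 * Real.pi * (1 : ℤ) * x) * Real.cos (2 * Real.pi * (1 : ℤ) * x)) := by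
      intro x
      have h0 : secondDifference lacunary (2 * x) (2 * (1 / 2) ^ (0 + 1)) = 0 := by
        rw [secondDifference, show (2 * (1 / 2 : ℝ) ^ (0 + 1)) = 1 by norm_num, periodic_lacunary,
          periodic_lacunary.sub_eq]
        ring
      have h1 : Real.cos (2 * Real.pi * (1 / 2) ^ (0 + 1)) = -1 := by
        rw [← Real.cos_pi]; congr 1; ring_nf
      rw [secondDifference_lacunary, h0, h1]
      simp only [pow_zero, Int.cast_one, mul_one]
      ring
    simp only [e]
    rw [intervalIntegral.integral_const_mul, integral_cos_mul_cos 1 1 (by norm_num)]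
    norm_num
  | succ N ih =>
    set t : ℝ := (1 / 2) ^ (N + 1) with ht
    have ht2 : 2 * (1 / 2 : ℝ) ^ (N + 1 + 1) = t := by rw [ht, pow_succ _ (N + 1)]; ring
    let g : ℝ → ℝ := fun x => 2 ^ (N + 1) * secondDifference lacunary x t *
      Real.cos (2 * Real.pi * (2 ^ N : ℤ) * x)
    have hgc : Continuous g := by
      have := hsd t
      fun_prop
    have hgp : Function.Periodic g 1 := fun x => by
      have h1 : Real.cos (2 * Real.pi * (2 ^ N : ℤ) * (x + 1)) =
          Real.cos (2 * Real.pi * (2 ^ N : ℤ) * x) := by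
        rw [← Real.cos_add_int_mul_two_pi (2 * Real.pi * (2 ^ N : ℤ) * x) (2 ^ N)]
        congr 1
        push_cast
        ring
      have h2 := hsdper t x
      simp only [g, h1]
      simp only at h2
      rw [h2]
    -- The first cosine is orthogonal to the test cosine; what remains is the previous integrand at
    -- 2x, which has the same integral.
    have e : ∀ x : ℝ, 2 ^ (N + 1 + 1) * secondDifference lacunary x ((1 / 2) ^ (N + 1 + 1)) *
        Real.cos (2 * Real.pi * (2 ^ (N + 1) : ℤ) * x) =
        (2 ^ (N + 1 + 1) * (2 * Real.cos (2 * Real.pi * (1 / 2) ^ (N + 1 + 1)) - 2)) *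
          (Real.cos (2 * Real.pi * (1 : ℤ) * x) * Real.cos (2 * Real.pi * (2 ^ (N + 1) : ℤ) * x))
        + g (2 * x) := by
      intro x
      have h1 : 2 * Real.pi * ((2 ^ N : ℤ) : ℝ) * (2 * x) =
          2 * Real.pi * ((2 ^ (N + 1) : ℤ) : ℝ) * x := by push_cast; ring
      simp only [g, h1]
      rw [secondDifference_lacunary, ht2]
      push_cast
      ring
    simp only [e]
    rw [intervalIntegral.integral_add (Continuous.intervalIntegrable (by fun_prop) _ _)
      (Continuous.intervalIntegrable (by fun_prop) _ _), intervalIntegral.integral_const_mul,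
      integral_cos_mul_cos 1 (2 ^ (N + 1)) (by positivity), hgp.integral_comp_two_mul hgc, ih,
      if_neg (by
        have : (1 : ℤ) < 2 ^ (N + 1) := one_lt_pow₀ (by norm_num) (by omega)
        omega)]
    ring

/-- The derivatives of φ(x + t) and φ(x - t) at t = 0 cancel. -/
theorem DifferentiableAt.tendsto_secondDifference {φ : ℝ → ℝ} {x : ℝ}
    (h : DifferentiableAt ℝ φ x) :
    Tendsto (fun t => t⁻¹ * secondDifference φ x t) (𝓝[≠] 0) (𝓝 0) := by
  have h1 : HasDerivAt (fun t => φ (x + t)) (deriv φ x) 0 :=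
    HasDerivAt.comp_const_add x 0 (by simpa using h.hasDerivAt)
  have h2 : HasDerivAt (fun t => φ (x - t)) (-deriv φ x) 0 :=
    HasDerivAt.comp_const_sub x 0 (by simpa using h.hasDerivAt)
  have h3 := (h1.add h2).tendsto_slope_zero
  simp only [add_neg_cancel, smul_eq_mul, Pi.add_apply, zero_add, add_zero, sub_zero] at h3
  refine h3.congr fun t => ?_
  rw [secondDifference]; ring

/-- Bounded variation would give differentiability almost everywhere, so the normalised second
differences would tend to 0 almost everywhere. The Zygmund bound dominates them, so their integrals
against the cosines would tend to 0 instead of staying at -4. -/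
theorem not_boundedVariationOn_lacunary : ¬ BoundedVariationOn lacunary (Set.Icc 0 1) := by
  intro h
  rw [← Set.uIcc_of_le zero_le_one] at h
  have hae := h.ae_differentiableAt_of_mem_uIcc
  have hseq : Tendsto (fun N : ℕ => (1 / 2 : ℝ) ^ (N + 1)) atTop (𝓝[≠] 0) := by
    refine tendsto_nhdsWithin_iff.2 ⟨?_, Eventually.of_forall fun N => by simp⟩
    exact (tendsto_pow_atTop_nhds_zero_of_lt_one (by norm_num) (by norm_num)).comp
      (tendsto_add_atTop_nat 1)
  have hinv : ∀ N : ℕ, ((1 / 2 : ℝ) ^ (N + 1))⁻¹ = 2 ^ (N + 1) := fun N => by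
    rw [← inv_pow]; norm_num
  have hlim := intervalIntegral.tendsto_integral_filter_of_dominated_convergence
    (μ := MeasureTheory.volume) (a := 0) (b := 1) (l := atTop) (f := fun _ : ℝ => (0 : ℝ))
    (F := fun (N : ℕ) x => 2 ^ (N + 1) * secondDifference lacunary x ((1 / 2) ^ (N + 1)) *
      Real.cos (2 * Real.pi * (2 ^ N : ℤ) * x)) (fun _ => 16 + 4 * Real.pi ^ 2)
    (Eventually.of_forall fun N => by
      have := continuous_lacunary
      refine Continuous.aestronglyMeasurable ?_
      unfold secondDifference
      fun_prop)
    (Eventually.of_forall fun N => Eventually.of_forall fun x _ => by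
      have h1 := abs_secondDifference_lacunary_le (t := (1 / 2) ^ (N + 1)) (by positivity) x
      rw [Real.norm_eq_abs, abs_mul, abs_mul, abs_of_pos (by positivity : (0 : ℝ) < 2 ^ (N + 1))]
      calc _ ≤ 2 ^ (N + 1) * ((16 + 4 * Real.pi ^ 2) * (1 / 2) ^ (N + 1)) * 1 := by
            gcongr; exact Real.abs_cos_le_one _
        _ = 16 + 4 * Real.pi ^ 2 := by
            rw [← hinv]; field_simp)
    intervalIntegrable_const
    (by
      filter_upwards [hae] with x hx hmem
      have hd := (hx (Set.uIoc_subset_uIcc hmem)).tendsto_secondDifference.comp hseq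
      have hd' := tendsto_zero_iff_norm_tendsto_zero.1 (hd.congr fun N => by
        rw [Function.comp, hinv])
      refine squeeze_zero_norm (fun N => ?_) hd'
      rw [norm_mul]
      exact mul_le_of_le_one_right (norm_nonneg _) (Real.abs_cos_le_one _))
  simp only [integral_secondDifference_lacunary, intervalIntegral.integral_zero] at hlim
  have := tendsto_nhds_unique hlim tendsto_const_nhds
  norm_num at this

end Examples
theorem theoremC :
    -- the criterion
    (∀ (f : UnitAddCircle ≃ₜ UnitAddCircle) (F : CircleDeg1Lift),
      IsCircleC1Diffeo F f → Irrational F.translationNumber →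
      HasBoundedZygmundVariation (logOfDeriv F) 0 1 →
      HasBoundedQuadraticVariation (logOfDeriv F) 0 1 →
        (¬ ∃ J : Set UnitAddCircle, IsWanderingInterval f J) ∧
        IsConjugateToRotation f F.translationNumber) ∧
    -- it is implied by the bounded variation condition
    (∀ (f : UnitAddCircle ≃ₜ UnitAddCircle) (F : CircleDeg1Lift),
      IsCircleC1Diffeo F f → BoundedVariationOn (logOfDeriv F) (Set.Icc 0 1) →
        HasBoundedZygmundVariation (logOfDeriv F) 0 1 ∧
        HasBoundedQuadraticVariation (logOfDeriv F) 0 1) ∧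
    -- it is implied by the Zygmund condition
    (∀ (f : UnitAddCircle ≃ₜ UnitAddCircle) (F : CircleDeg1Lift),
      IsCircleC1Diffeo F f → ZygmundCondition (logOfDeriv F) →
        HasBoundedZygmundVariation (logOfDeriv F) 0 1 ∧
        HasBoundedQuadraticVariation (logOfDeriv F) 0 1) ∧
    -- neither of these two conditions implies the other, so both implications are strict
    (∃ (f : UnitAddCircle ≃ₜ UnitAddCircle) (F : CircleDeg1Lift),
      IsCircleC1Diffeo F f ∧ Irrational F.translationNumber ∧
      BoundedVariationOn (logOfDeriv F) (Set.Icc 0 1) ∧ ¬ ZygmundCondition (logOfDeriv F)) ∧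
    (∃ (f : UnitAddCircle ≃ₜ UnitAddCircle) (F : CircleDeg1Lift),
      IsCircleC1Diffeo F f ∧ Irrational F.translationNumber ∧
      ZygmundCondition (logOfDeriv F) ∧ ¬ BoundedVariationOn (logOfDeriv F) (Set.Icc 0 1)) := by
  refine ⟨fun f F hf hα hz hq => hf.isConjugateToRotation hα hz hq,
    fun f F hf h => h.zygmund_and_quadratic hf.continuous_logOfDeriv.continuousOn,
    fun f F hf h => ?_, ?_, ?_⟩
  · obtain ⟨M, hM⟩ := exists_abs_le_of_periodic hf.continuous_logOfDeriv (logOfDeriv_add_int F)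
    exact h.zygmund_and_quadratic hM
  · obtain ⟨f, F, c, hf, hα, hF⟩ :=
      exists_isCircleC1Diffeo_logOfDeriv_eq continuous_cusp periodic_cusp
    refine ⟨f, F, hf, hα, ?_, ?_⟩ <;> rw [hF]
    · exact boundedVariationOn_cusp.sub_const c
    · exact fun h => not_zygmundCondition_cusp (zygmundCondition_sub_const.1 h)
  · obtain ⟨f, F, c, hf, hα, hF⟩ :=
      exists_isCircleC1Diffeo_logOfDeriv_eq continuous_lacunary periodic_lacunary
    refine ⟨f, F, hf, hα, ?_, fun h => not_boundedVariationOn_lacunary ?_⟩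
    · rw [hF]
      exact zygmundCondition_sub_const.2 zygmundCondition_lacunary
    · have := (hF ▸ h).sub_const (-c)
      simpa using this
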